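/- Let $\mathbb K\in\{\mathbb R,\mathbb C\}$, let $B$ and $\bar B\neq\{0\}$ be Banach spaces over $\mathbb K$, let $1\le l\le k$ and $q\ge 2k+2$ be integers, $G\in C^q(B,\bar B)$ with $G[0]=0$, and let $z_0(\varepsilon)=\varepsilon\bar z_1+\dots+\frac1{k!}\varepsilon^k\bar z_k+O(|\varepsilon|^{k+1})$ be a $C^q$-curve in $B$, defined for $\varepsilon\in\mathbb K$ near $0$, whose first nonzero coefficient is $\bar z_l$. Write $G_0^m$ for the $m$-th derivative of $G$ at $0$. **Fine resolution.** Put $N_0=B$, $R_0^c=\bar B$, $\bar S_1=G_0^1$, $\bar S_2=2G_0^2\bar z_1$. For $i=1,\dots,k+1$ let $$S_i=P_{R_{i-1}^c}\bar S_i|_{N_{i-1}}:N_{i-1}\to R_{i-1}^c,\qquad N_i=\ker S_i,\quad R_i=\operatorname{ran}S_i,$$ and choose complements $N_i^c$, $R_i^c$ with $N_{i-1}=N_i^c\oplus N_i$ and $R_{i-1}^c=R_i\oplus R_i^c$; it is assumed that this is possible with all subspaces closed. Thus $S_i:N_i^c\to R_i$ is bijective, $P_{R_i}$ and $P_{R_i^c}$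 denote the continuous projections belonging to $\bar B=R_1\oplus\dots\oplus R_i\oplus R_i^c$, and with $N^c=N_1^c\oplus\dots\oplus N_{k+1}^c$ $$B=N^c\oplus N_{k+1},\qquad \bar B=R_1\oplus\dots\oplus R_{k+1}\oplus R_{k+1}^c .$$ The complements are chosen such that $\bar z_l\notin N^c$. The operators $\bar S_{j+1}\in L[B,\bar B]$, $2\le j\le k$, are defined recursively as follows. Let $c_{n,i}=\binom n{i-1}\binom{2(i-1)}{i-1}^{-1}$, $C^n=\operatorname{Diag}[c_{n,1},c_{n,2},\dots]$, and let $E^j=(E_{i,m})_{1\le i,m\le j}$ be the upper triangular operator matrix with $E_{m,m}=I_B$ and $E_{i,m}=-S_i^{-1}P_{R_i}\sum_{v=i+1}^m\bar S_vE_{v,m}$ for $i<m$. For $n=2j$ and for $n=2j-1$ write $$(C^n)^{-1}E^jC^n=\begin{pmatrix}\alpha^n&\bar\alpha^n\\A^n&\bar A^n\end{pmatrix},$$ where the first row and the last column ($j$ columns in all) are split off. Let $M^3=I_B$ and, for $j\ge2$, let $M^{2j+1}\in L[B^j,B^j]$ consist of the first $j$ rows of $$\begin{pmatrix}(\alpha^{2j}\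 \ \bar\alpha^{2j})\\ \alpha^{2j-1}(A^{2j}\ \ \bar A^{2j})\\ M^{2j-1}A^{2j-1}(A^{2j}\ \ \bar A^{2j})\end{pmatrix}.$$ Finally, for $j\ge 2$, $$\bar S_{j+1}=[W^{2j}_{2j-1},\dots,W^{2j}_{j}]\begin{pmatrix}\bar\alpha^{2j-1}\\M^{2j-1}\bar A^{2j-1}\end{pmatrix}+\frac{(2j)!}{(j!)^2}G_0^2\bar z_j,$$ $$W^{2j}_\mu=\frac1{\mu!}\sum_{\beta=1}^{2j}\ \sum_{\substack{n_1+\dots+n_{j-1}+1=\beta\\ n_1+2n_2+\dots+(j-1)n_{j-1}+\mu=2j}}\frac{(2j)!}{n_1!\cdots n_{j-1}!}\,G_0^\beta\prod_{\tau=1}^{j-1}\Big(\frac{\bar z_\tau}{\tau!}\Big)^{n_\tau}\in L[B,\bar B].$$ **Cone.** Let $\bar z_{l,k+1}\ne0$ be the component of $\bar z_l$ in $N_{k+1}$, let $P_{k+1}$ be closed with $N_{k+1}=P_{k+1}\oplus\operatorname{span}\{\bar z_{l,k+1}\}$, and let $U_i^c\subset N_i^c$ and $U_{k+1}^p\subset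 P_{k+1}$ be bounded, (relatively) open and contain $0$. With $\widehat M_{k+1}=\operatorname{diag}(I_B,M^{2k+1})$ the cone $C_k$ is the set of all points $$z_0(\varepsilon)+\Big[\tfrac{\varepsilon^{2k+1}}{(2k+1)!}\ \cdots\ \tfrac{\varepsilon^{k+1}}{(k+1)!}\Big]\widehat M_{k+1}\begin{pmatrix}n_1^c\\\vdots\\n_{k+1}^c+p\end{pmatrix},\qquad n_i^c\in U_i^c,\ p\in U_{k+1}^p,\ 0<|\varepsilon|<\rho$$ (for some small $\rho>0$). It is called *$k$-transversal* (with respect to $G$) if $R_{k+1}^c=\{0\}$, i.e. $\bar B=R_1\oplus\dots\oplus R_{k+1}$. **Statement.** Let $P^k(\varepsilon)$ be the Taylor polynomial of degree $k$ at $\varepsilon=0$ of the operator family $\varepsilon\mapsto G'[z_0(\varepsilon)]\in L[B,\bar B]$. For every fine resolution and every cone $C_k$ as above, the following are equivalent. (i) The cone $C_k$ is $k$-transversal. (ii) There are closed subspaces $U\ne\{0\}$, $V\neq\{0\}$ with $B=U\oplus V$ such that $G'[z_0(\varepsilon)]|_U\in GL[U,\bar B]$ for all sufficiently small $\varepsilon\neq0$,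 $\|(G'[z_0(\varepsilon)]|_U)^{-1}\|=O(|\varepsilon|^{-k})$ as $\varepsilon\to0$, and, for some $\delta>0$ and some continuous $Q:\{|\varepsilon|<\delta\}\to L[V,B]$, $G'[z_0(\varepsilon)]\,[I_B+\varepsilon Q(\varepsilon)]\,v=0$ for all $v\in V$, $|\varepsilon|<\delta$. (iii) There are closed subspaces $U\ne\{0\}$, $V\neq\{0\}$ with $B=U\oplus V$ such that $P^k(\varepsilon)|_U\in GL[U,\bar B]$ for all sufficiently small $\varepsilon\neq0$, $\|(P^k(\varepsilon)|_U)^{-1}\|=O(|\varepsilon|^{-k})$ as $\varepsilon\to0$, and, for some $\delta>0$ and some continuous $Q:\{|\varepsilon|<\delta\}\to L[V,B]$, $\|P^k(\varepsilon)\,[I_B+\varepsilon Q(\varepsilon)]|_V\|=O(|\varepsilon|^{k+1})$ as $\varepsilon\to0$. -/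

import Mathlib

open Filter Topology Asymptotics
open scoped Nat

namespace FineRes

noncomputable section

section Operators

variable {𝕜 E F : Type*} [RCLike 𝕜] [NormedAddCommGroup E] [NormedSpace 𝕜 E]
  [NormedAddCommGroup F] [NormedSpace 𝕜 F]

/-- The coefficient `z̄_j` of the expansion `z₀(ε) = ∑ ε^j / j! • z̄_j`. -/
def curveCoeff (z₀ : 𝕜 → E) (j : ℕ) : E := iteratedDeriv j z₀ 0

/-- The operator `G_0^{m+1} v_0 ⋯ v_{m-1} ∈ L[E, F]`, where `G_0^{m+1}` is the derivative of order
`m + 1` of `G` at the origin and the last argument is left free. -/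
def derivOp (𝕜 : Type*) {E F : Type*} [RCLike 𝕜] [NormedAddCommGroup E] [NormedSpace 𝕜 E]
    [NormedAddCommGroup F] [NormedSpace 𝕜 F] (G : E → F) (m : ℕ) (v : Fin m → E) : E →L[𝕜] F :=
  (iteratedFDeriv 𝕜 (m + 1) G 0).curryRight v

/-- The operator `W_μ^{2k}(z_{k-1}, …, z_1)`.  The sum runs over ordered tuples
`(t_1, …, t_m)` of indices in `{1, …, k-1}` with `t_1 + ⋯ + t_m + μ = 2k` (an element `t i` of
`Fin (k - 1)` stands for the index `t i + 1`).  Since `m! / (n_1! ⋯ n_{k-1}!)` ordered tuples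
contain the index `τ` exactly `n_τ` times, this is the sum over multi-indices
`(n_1, …, n_{k-1})` with coefficients `(2k)! / (μ! n_1! ⋯ n_{k-1}!)`. -/
def W (G : E → F) (z : ℕ → E) (k μ : ℕ) : E →L[𝕜] F :=
  (((2 * k)! : 𝕜) / (μ ! : 𝕜)) • ∑ m ∈ Finset.range (2 * k), ((m ! : 𝕜)⁻¹) •
    ∑ t : Fin m → Fin (k - 1) with (∑ i, ((t i : ℕ) + 1)) + μ = 2 * k,
      derivOp 𝕜 G m (fun i => ((((t i : ℕ) + 1)! : 𝕜)⁻¹) • z ((t i : ℕ) + 1))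

/-- The numbers `c_{n,l} = binom(n, l-1) / binom(2(l-1), l-1)`, `l ≥ 1`. -/
def cNum (𝕜 : Type*) [RCLike 𝕜] (n l : ℕ) : 𝕜 :=
  (n.choose (l - 1) : 𝕜) / ((2 * (l - 1)).choose (l - 1) : 𝕜)

/-- The entries of the upper triangular operator matrix `E`: identities on the diagonal and
`E_{i,j} = - S_i⁻¹ P_{R_i} ∑_{v=i+1}^{j} S̄_v E_{v,j}` for `i < j`.  Here `Sb v` is `S̄_v` and `T i` is
`S_i⁻¹ P_{R_i}`. -/
def Eop (Sb : ℕ → E →L[𝕜] F) (T : ℕ → F →L[𝕜] E) (i j : ℕ) : E →L[𝕜] E :=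
  if i = j then ContinuousLinearMap.id 𝕜 E
  else if i < j then
    -((T i) ∘L ∑ v : Fin (j - i), (Sb (i + 1 + v)) ∘L (Eop Sb T (i + 1 + v) j))
  else 0
termination_by j - i
decreasing_by omega

/-- The entries of `(C^n)⁻¹ E C^n` with `C^n = Diag(c_{n,1}, c_{n,2}, …)`. -/
def Ec (Sb : ℕ → E →L[𝕜] F) (T : ℕ → F →L[𝕜] E) (n i j : ℕ) : E →L[𝕜] E :=
  (cNum 𝕜 n j / cNum 𝕜 n i) • Eop Sb T i j

/-- The entries (row `i`, column `j`, with `1 ≤ i, j ≤ k`) of the operator matrix `M^{2k+1}`.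
`M^3` is the identity.  For `k ≥ 2`, the first row is the first row of `(C^{2k})⁻¹ E^k C^{2k}`, the
second row is `α^{2k-1} (A^{2k} Ā^{2k})`, and the remaining rows are the first `k - 2` rows of
`M^{2k-1} A^{2k-1} (A^{2k} Ā^{2k})`. -/
def Mop (Sb : ℕ → E →L[𝕜] F) (T : ℕ → F →L[𝕜] E) : ℕ → ℕ → ℕ → E →L[𝕜] E
  | 0, _, _ => 0
  | 1, i, j => if i = j then ContinuousLinearMap.id 𝕜 E else 0
  | k + 2, i, j =>
    match i with
    | 0 => 0
    | 1 => Ec Sb T (2 * (k + 2)) 1 j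
    | 2 => ∑ v ∈ Finset.Icc 1 (k + 1),
        (Ec Sb T (2 * (k + 2) - 1) 1 v) ∘L (Ec Sb T (2 * (k + 2)) (v + 1) j)
    | i + 3 => ∑ u ∈ Finset.Icc 1 (k + 1), ∑ v ∈ Finset.Icc 1 (k + 1),
        (Mop Sb T (k + 1) (i + 1) u) ∘L (Ec Sb T (2 * (k + 2) - 1) (u + 1) v) ∘L
          (Ec Sb T (2 * (k + 2)) (v + 1) j)

/-- The entries, `1 ≤ v ≤ k`, of the column `(ᾱ^{2k-1}, M^{2k-1} Ā^{2k-1})` (for `k ≥ 2`). -/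
def Xcol (Sb : ℕ → E →L[𝕜] F) (T : ℕ → F →L[𝕜] E) (k v : ℕ) : E →L[𝕜] E :=
  if v = 1 then Ec Sb T (2 * k - 1) 1 k
  else ∑ u ∈ Finset.Icc 1 (k - 1),
    (Mop Sb T (k - 1) (v - 1) u) ∘L (Ec Sb T (2 * k - 1) (u + 1) k)

/-- The right-hand side
`[W_{2k-1}^{2k}, …, W_k^{2k}] (ᾱ^{2k-1}, M^{2k-1} Ā^{2k-1}) + (2k)! / (k!)² G_0^2 z̄_k`
of the recursion for `S̄_{k+1}`, `k ≥ 2`.  It involves `S̄_v` for `v ≤ k` only. -/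
def SbarStep (G : E → F) (z : ℕ → E) (Sb : ℕ → E →L[𝕜] F) (T : ℕ → F →L[𝕜] E) (k : ℕ) :
    E →L[𝕜] F :=
  (∑ v ∈ Finset.Icc 1 k, (W G z k (2 * k - v)) ∘L (Xcol Sb T k v)) +
    (((2 * k)! : 𝕜) / ((k ! : 𝕜) ^ 2)) • derivOp 𝕜 G 1 (fun _ => z k)

/-- The operators `S̄_1, S̄_2, …` (the value at `0` is irrelevant).  The truncation in the last
clause only makes the recursion well-founded, as `SbarStep` does not use the values cut off. -/
def Sbar (G : E → F) (z : ℕ → E) (T : ℕ → F →L[𝕜] E) : ℕ → E →L[𝕜] F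
  | 0 => 0
  | 1 => fderiv 𝕜 G 0
  | 2 => (2 : 𝕜) • derivOp 𝕜 G 1 (fun _ => z 1)
  | n + 3 => SbarStep G z (fun v => if _h : v < n + 3 then Sbar G z T v else 0) T (n + 2)

end Operators

/-- The choices entering a fine resolution: the complements `N_i^c` and `R_i^c`, together with
the projections `P_{R_i^c}` and the operators `S_i⁻¹ P_{R_i}` that belong to them. -/
structure ResolutionData (𝕜 E F : Type*) [RCLike 𝕜] [NormedAddCommGroup E] [NormedSpace 𝕜 E]
    [NormedAddCommGroup F] [NormedSpace 𝕜 F] where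
  /-- `N_i^c`, `i ≥ 1` -/
  Nc : ℕ → Submodule 𝕜 E
  /-- `R_i^c`, `i ≥ 0` -/
  Rc : ℕ → Submodule 𝕜 F
  /-- `P_{R_i^c}`, `i ≥ 0` -/
  PRc : ℕ → F →L[𝕜] F
  /-- `S_i⁻¹ P_{R_i}`, `i ≥ 1` -/
  SinvP : ℕ → F →L[𝕜] E

namespace ResolutionData

variable {𝕜 E F : Type*} [RCLike 𝕜] [NormedAddCommGroup E] [NormedSpace 𝕜 E]
  [NormedAddCommGroup F] [NormedSpace 𝕜 F]

/-- `S̄_i` for the curve `z₀`. -/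
def sbar (D : ResolutionData 𝕜 E F) (G : E → F) (z₀ : 𝕜 → E) (i : ℕ) : E →L[𝕜] F :=
  Sbar G (curveCoeff z₀) D.SinvP i

/-- `P_{R_i^c} S̄_{i+1}`; its restriction to `N_i` is `S_{i+1}`. -/
def S (D : ResolutionData 𝕜 E F) (G : E → F) (z₀ : 𝕜 → E) (i : ℕ) : E →L[𝕜] F :=
  (D.PRc i) ∘L (D.sbar G z₀ (i + 1))

/-- The kernels `N_0 = E` and `N_{i+1} = N[S_{i+1}] ⊆ N_i`. -/
def N (D : ResolutionData 𝕜 E F) (G : E → F) (z₀ : 𝕜 → E) : ℕ → Submodule 𝕜 E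
  | 0 => ⊤
  | i + 1 => D.N G z₀ i ⊓ LinearMap.ker (D.S G z₀ i : E →ₗ[𝕜] F)

/-- The ranges `R_{i+1} = R[S_{i+1}]` (`R 0` is irrelevant). -/
def R (D : ResolutionData 𝕜 E F) (G : E → F) (z₀ : 𝕜 → E) : ℕ → Submodule 𝕜 F
  | 0 => ⊥
  | i + 1 => (D.N G z₀ i).map (D.S G z₀ i : E →ₗ[𝕜] F)

/-- `N^c = N_1^c + ⋯ + N_{k+1}^c`. -/
def NcSum (D : ResolutionData 𝕜 E F) (k : ℕ) : Submodule 𝕜 E :=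
  ⨆ i ∈ Finset.Icc 1 (k + 1), D.Nc i

/-- The entries, `1 ≤ i, j ≤ k + 1`, of the block diagonal matrix `M̂_{k+1} = diag(I, M^{2k+1})`. -/
def Mhat (D : ResolutionData 𝕜 E F) (G : E → F) (z₀ : 𝕜 → E) (k i j : ℕ) : E →L[𝕜] E :=
  if i = 1 ∧ j = 1 then ContinuousLinearMap.id 𝕜 E
  else if 2 ≤ i ∧ 2 ≤ j then Mop (D.sbar G z₀) D.SinvP k (i - 1) (j - 1)
  else 0

end ResolutionData

/-- A fine resolution of `E` and `F` of depth `k + 1` along the curve `z₀`, whose leading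
coefficient is `z̄_l`:
`E = N_1^c ⊕ ⋯ ⊕ N_{k+1}^c ⊕ N_{k+1}`, `F = R_1 ⊕ ⋯ ⊕ R_{k+1} ⊕ R_{k+1}^c`, with closed subspaces,
continuous projections, and `z̄_l ∉ N^c`. -/
structure FineResolution {𝕜 E F : Type*} [RCLike 𝕜] [NormedAddCommGroup E] [NormedSpace 𝕜 E]
    [NormedAddCommGroup F] [NormedSpace 𝕜 F] (G : E → F) (z₀ : 𝕜 → E) (k l : ℕ)
    extends ResolutionData 𝕜 E F where
  Rc_zero : Rc 0 = ⊤
  PRc_zero : PRc 0 = ContinuousLinearMap.id 𝕜 F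
  isClosed_Nc : ∀ i ≤ k, IsClosed (Nc (i + 1) : Set E)
  isClosed_R : ∀ i ≤ k, IsClosed (toResolutionData.R G z₀ (i + 1) : Set F)
  isClosed_Rc : ∀ i ≤ k, IsClosed (Rc (i + 1) : Set F)
  /-- `N_i = N_{i+1}^c ⊕ N_{i+1}` -/
  N_sup : ∀ i ≤ k, Nc (i + 1) ⊔ toResolutionData.N G z₀ (i + 1) = toResolutionData.N G z₀ i
  N_inf : ∀ i ≤ k, Nc (i + 1) ⊓ toResolutionData.N G z₀ (i + 1) = ⊥
  /-- `R_i^c = R_{i+1} ⊕ R_{i+1}^c` -/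
  R_sup : ∀ i ≤ k, toResolutionData.R G z₀ (i + 1) ⊔ Rc (i + 1) = Rc i
  R_inf : ∀ i ≤ k, toResolutionData.R G z₀ (i + 1) ⊓ Rc (i + 1) = ⊥
  /-- `P_{R_{i+1}^c}` is the projection along `R_1 ⊕ ⋯ ⊕ R_{i+1}` onto `R_{i+1}^c`. -/
  PRc_of_mem_Rc : ∀ i ≤ k, ∀ y ∈ Rc (i + 1), PRc (i + 1) y = y
  PRc_of_mem_R : ∀ i ≤ k, ∀ j ≤ i, ∀ y ∈ toResolutionData.R G z₀ (j + 1), PRc (i + 1) y = 0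
  /-- `SinvP (i + 1) y` is the element of `N_{i+1}^c` which `S_{i+1}` maps to
  `P_{R_{i+1}} y = P_{R_i^c} y - P_{R_{i+1}^c} y`. -/
  SinvP_mem : ∀ i ≤ k, ∀ y, SinvP (i + 1) y ∈ Nc (i + 1)
  S_SinvP : ∀ i ≤ k, ∀ y, toResolutionData.S G z₀ i (SinvP (i + 1) y) = PRc i y - PRc (i + 1) y
  /-- `z̄_l ∉ N^c` -/
  leading_notMem : curveCoeff z₀ l ∉ toResolutionData.NcSum k

/-- The data of the cone `C_k` along the curve `z₀` built on a fine resolution: the component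
`z̄_{l,k+1}` of `z̄_l` in `N_{k+1}`, a closed complement `P_{k+1}` of it in `N_{k+1}`, bounded
relatively open neighbourhoods of zero in `N_1^c, …, N_{k+1}^c` and `P_{k+1}`, and a bound for
`|ε|`. -/
structure Cone {𝕜 E F : Type*} [RCLike 𝕜] [NormedAddCommGroup E] [NormedSpace 𝕜 E]
    [NormedAddCommGroup F] [NormedSpace 𝕜 F] (G : E → F) (z₀ : 𝕜 → E) (k l : ℕ)
    extends FineResolution G z₀ k l where
  /-- `z̄_{l,k+1}` -/
  zl : E
  zl_mem : zl ∈ toResolutionData.N G z₀ (k + 1)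
  sub_zl_mem : curveCoeff z₀ l - zl ∈ toResolutionData.NcSum k
  /-- `P_{k+1}` -/
  P : Submodule 𝕜 E
  isClosed_P : IsClosed (P : Set E)
  P_sup : P ⊔ Submodule.span 𝕜 {zl} = toResolutionData.N G z₀ (k + 1)
  P_inf : P ⊓ Submodule.span 𝕜 {zl} = ⊥
  /-- `U_i^c` -/
  Uc : ℕ → Set E
  Uc_open : ∀ i ∈ Finset.Icc 1 (k + 1), ∃ O : Set E, IsOpen O ∧ Uc i = O ∩ Nc i
  Uc_bounded : ∀ i ∈ Finset.Icc 1 (k + 1), Bornology.IsBounded (Uc i)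
  zero_mem_Uc : ∀ i ∈ Finset.Icc 1 (k + 1), (0 : E) ∈ Uc i
  /-- `U_{k+1}^p` -/
  Up : Set E
  Up_open : ∃ O : Set E, IsOpen O ∧ Up = O ∩ P
  Up_bounded : Bornology.IsBounded Up
  zero_mem_Up : (0 : E) ∈ Up
  ρ : ℝ
  ρ_pos : 0 < ρ

namespace Cone

variable {𝕜 E F : Type*} [RCLike 𝕜] [NormedAddCommGroup E] [NormedSpace 𝕜 E]
  [NormedAddCommGroup F] [NormedSpace 𝕜 F] {G : E → F} {z₀ : 𝕜 → E} {k l : ℕ}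

/-- The map `Z_k(ε, n_1, …, n_{k+1}, p)`. -/
def Z (C : Cone G z₀ k l) (ε : 𝕜) (n : ℕ → E) (p : E) : E :=
  z₀ ε + ∑ i ∈ Finset.Icc 1 (k + 1), (ε ^ (2 * k + 2 - i) / ((2 * k + 2 - i)! : 𝕜)) •
    ∑ j ∈ Finset.Icc 1 (k + 1),
      C.toResolutionData.Mhat G z₀ k i j (if j = k + 1 then n j + p else n j)

/-- The cone `C_k` as a subset of `E`. -/
def carrier (C : Cone G z₀ k l) : Set E :=
  {z | ∃ (ε : 𝕜) (n : ℕ → E) (p : E), 0 < ‖ε‖ ∧ ‖ε‖ < C.ρ ∧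
    (∀ i ∈ Finset.Icc 1 (k + 1), n i ∈ C.Uc i) ∧ p ∈ C.Up ∧ z = C.Z ε n p}

/-- The cone is `k`-transversal with respect to `G`: `R_{k+1}^c = {0}`, that is,
`F = R_1 ⊕ ⋯ ⊕ R_{k+1}`. -/
def IsTransversal (C : Cone G z₀ k l) : Prop := C.Rc (k + 1) = ⊥

end Cone

section Splitting

variable {𝕜 E F : Type*} [RCLike 𝕜] [NormedAddCommGroup E] [NormedSpace 𝕜 E]
  [NormedAddCommGroup F] [NormedSpace 𝕜 F]

/-- The operator family `ε ↦ G'[z₀(ε)]`. -/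
def linFamily (G : E → F) (z₀ : 𝕜 → E) (ε : 𝕜) : E →L[𝕜] F := fderiv 𝕜 G (z₀ ε)

/-- The Taylor polynomial `P^k(ε)` of degree `k` of the family `ε ↦ G'[z₀(ε)]` at `ε = 0`. -/
def taylorFamily (G : E → F) (z₀ : 𝕜 → E) (k : ℕ) (ε : 𝕜) : E →L[𝕜] F :=
  ∑ j ∈ Finset.range (k + 1), (ε ^ j / (j ! : 𝕜)) • iteratedDeriv j (linFamily G z₀) 0

/-- `L(ε)|_U ∈ GL[U, F]` for small `ε ≠ 0`, and `‖(L(ε)|_U)⁻¹‖ = O(|ε|^{-k})` as `ε → 0`. -/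
def InvertibleOfOrder (L : 𝕜 → E →L[𝕜] F) (U : Submodule 𝕜 E) (k : ℕ) : Prop :=
  (∀ᶠ ε in 𝓝[≠] (0 : 𝕜), (L ε ∘L U.subtypeL).IsInvertible) ∧
    (fun ε : 𝕜 => (L ε ∘L U.subtypeL).inverse) =O[𝓝[≠] (0 : 𝕜)] fun ε : 𝕜 => (‖ε‖ ^ k)⁻¹

/-- `I + ε Q(ε) ∈ L[V, E]`. -/
def perturbedInclusion {V : Submodule 𝕜 E} (Q : 𝕜 → V →L[𝕜] E) (ε : 𝕜) : V →L[𝕜] E :=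
  V.subtypeL + ε • Q ε

end Splitting

end

end FineRes

/-! Let `L(ε)` be `G'[z₀(ε)]` or its Taylor polynomial of degree `k`, with Taylor coefficients
`L_v`. The point is to see the combinatorial recursion for `S̄_j` as a Jordan-chain construction for
`L`. With the weights `wt m = m!/(2m)!` and operators `chainCoeff` that satisfy a recursion free of
factorials, all entries of `M^{2k+1}` are factorial quotients times `chainCoeff` (`Mop_eq`,
`Xcol_eq`). Faà di Bruno's formula for `G'[z₀(ε)]` then gives `wt j • S̄_{j+1} = ∑ L_v ∘ chainCoeff
v j` (`wt_smul_Sbar`): up to its weight, `S̄_{j+1}` is the coefficient of `ε^j` in `L(ε)` applied to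
the chain polynomial of order `j`.

The matrix `E` corrects `S̄_{j+1}` to `P_{R_j^c} S̄_{j+1}` (`sum_sbar_comp_Eop`). Hence the chain
polynomial of order `j + 1` maps `x ∈ N_j` to `ε^j (wt j • S_{j+1} x + O(ε))` (`exists_chain_succ`),
and on `N_{j+1} = ker S_{j+1}` one more power of `ε` is gained. Gluing the chain polynomials along
`E = N_1^c ⊕ ⋯ ⊕ N_{k+1}^c ⊕ N_{k+1}` gives a near-identity family `blowUp` (`exists_blowUp`) with
`L ∘ blowUp = (leadOp + ε A) ∘ scale + ε^{k+1} H ∘ lastProj`, where `scale` multiplies `N_{i+1}^c`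
by `ε^i` and `leadOp` maps `N^c` bijectively onto `R_1 ⊕ ⋯ ⊕ R_{k+1}`.

If `R_{k+1}^c = 0`, then `leadOp + ε A` has a right inverse near the origin. It serves to remove the
term of order `k + 1` exactly and to invert `L(ε)` on `U = N^c` with a loss of `ε^{-k}`, while `V =
N_{k+1}` carries the kernel (`exists_splitting`). Conversely, let `L(ε)` be invertible on some `U`
with inverse `O(|ε|^{-k})` (`Rc_eq_bot`). Solving `L(ε) u = y` makes the term of order `k + 1` only
`O(ε)`, and `P_{R_{k+1}^c}` annihilates `leadOp`; so `P_{R_{k+1}^c} y = O(ε)`, which must be `0`.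
Only the Taylor coefficients up to order `k` enter (`IsAdapted`), so one argument serves both
families. -/

namespace FineRes

/-! ### Taylor's formula over `ℝ` or `ℂ`, and uniqueness of coefficients. -/

section Taylor

/-- Restriction to real scalars makes the integral remainder on the segment from `0` to `x`
available; the derivatives over `ℝ` and over `𝕜` are the same multilinear maps, and the derivative
of order `n + 1` is bounded near `0` by continuity. -/
theorem taylor_isBigO_of_isScalarTower {𝕜 E F : Type*} [RCLike 𝕜]
    [NormedAddCommGroup E] [NormedSpace 𝕜 E] [NormedSpace ℝ E] [IsScalarTower ℝ 𝕜 E]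
    [NormedAddCommGroup F] [NormedSpace 𝕜 F] [NormedSpace ℝ F] [IsScalarTower ℝ 𝕜 F]
    [CompleteSpace F] {n : ℕ} {f : E → F} (hf : ContDiffAt 𝕜 (n + 1 : ℕ) f 0) :
    (fun x => f x - ∑ m ∈ Finset.range (n + 1),
      ((m ! : 𝕜)⁻¹) • iteratedFDeriv 𝕜 m f 0 (fun _ => x)) =O[𝓝 0] fun x => ‖x‖ ^ (n + 1) := by
  have hfR : ContDiffAt ℝ (n + 1 : ℕ) f 0 := hf.restrict_scalars ℝ
  have hev : ∀ᶠ x in 𝓝 (0 : E), ContDiffAt ℝ (n + 1 : ℕ) f x := hfR.eventually (by simp)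
  have hcont : ContinuousAt (iteratedFDeriv ℝ (n + 1) f) 0 :=
    (hfR.iteratedFDeriv_right (i := n + 1) (m := 0) (by simp)).continuousAt
  have hb : ∀ᶠ x in 𝓝 (0 : E), ‖iteratedFDeriv ℝ (n + 1) f x‖ <
      ‖iteratedFDeriv ℝ (n + 1) f 0‖ + 1 :=
    hcont.norm.eventually (gt_mem_nhds (lt_add_one _))
  obtain ⟨r, hr, hball⟩ := Metric.eventually_nhds_iff_ball.1 (hev.and hb)
  refine IsBigO.of_bound ((n ! : ℝ)⁻¹ * (‖iteratedFDeriv ℝ (n + 1) f 0‖ + 1)) ?_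
  filter_upwards [Metric.ball_mem_nhds 0 hr] with x hx
  have hmem : ∀ t ∈ Set.Icc (0 : ℝ) 1, (0 : E) + t • x ∈ Metric.ball (0 : E) r := by
    intro t ht
    rw [mem_ball_zero_iff] at hx ⊢
    rw [zero_add, norm_smul, Real.norm_of_nonneg ht.1]
    exact (mul_le_of_le_one_left (norm_nonneg _) ht.2).trans_lt hx
  have key := map_add_eq_sum_add_integral_iteratedFDeriv (f := f) (x := 0) (y := x) (n := n)
    (fun t ht => (hball _ (hmem t ht)).1)
  have hsum : ∑ m ∈ Finset.range (n + 1), ((m ! : 𝕜)⁻¹) • iteratedFDeriv 𝕜 m f 0 (fun _ => x)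
      = ∑ m ∈ Finset.range (n + 1), ((m ! : ℝ)⁻¹) • iteratedFDeriv ℝ m f 0 (fun _ => x) := by
    refine Finset.sum_congr rfl fun m hm => ?_
    have hm' : m ≤ n + 1 := (Finset.mem_range.1 hm).le
    have h1 : ContDiffAt 𝕜 m f 0 := hf.of_le (by exact_mod_cast hm')
    rw [← (h1.restrictScalars_iteratedFDeriv_eventuallyEq (𝕜 := ℝ)).eq_of_nhds]
    simp only [Function.comp_apply, ContinuousMultilinearMap.coe_restrictScalars]
    rw [← algebraMap_smul 𝕜 ((m ! : ℝ)⁻¹)]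
    simp
  rw [zero_add] at key
  rw [hsum, key, add_sub_cancel_left, norm_smul, norm_inv, norm_pow, norm_norm, mul_assoc,
    RCLike.norm_natCast]
  gcongr
  have := intervalIntegral.norm_integral_le_of_norm_le_const (a := (0 : ℝ)) (b := 1)
    (f := fun t => (1 - t) ^ n • iteratedFDeriv ℝ (n + 1) f (0 + t • x) (fun _ ↦ x))
    (C := (‖iteratedFDeriv ℝ (n + 1) f 0‖ + 1) * ‖x‖ ^ (n + 1)) ?_
  · simpa using this
  · intro t ht
    rw [Set.uIoc_of_le zero_le_one] at ht
    have ht' : t ∈ Set.Icc (0 : ℝ) 1 := ⟨ht.1.le, ht.2⟩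
    rw [norm_smul]
    have h1 : ‖(1 - t) ^ n‖ ≤ 1 := by
      rw [norm_pow, Real.norm_of_nonneg (by linarith [ht.2])]
      exact pow_le_one₀ (by linarith [ht.2]) (by linarith [ht.1])
    have h2 : ‖iteratedFDeriv ℝ (n + 1) f (0 + t • x) (fun _ ↦ x)‖ ≤
        (‖iteratedFDeriv ℝ (n + 1) f 0‖ + 1) * ‖x‖ ^ (n + 1) := by
      refine (ContinuousMultilinearMap.le_opNorm _ _).trans ?_
      simp only [Finset.prod_const, Finset.card_univ, Fintype.card_fin]
      gcongr
      exact (hball _ (hmem t ht')).2.le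
    calc _ ≤ 1 * _ := mul_le_mul h1 h2 (norm_nonneg _) zero_le_one
      _ = _ := one_mul _

/-- Taylor's formula at the origin over `ℝ` or `ℂ`. -/
theorem taylor_isBigO {𝕜 E F : Type*} [RCLike 𝕜]
    [NormedAddCommGroup E] [NormedSpace 𝕜 E] [NormedAddCommGroup F] [NormedSpace 𝕜 F]
    [CompleteSpace F] {n : ℕ} {f : E → F} (hf : ContDiffAt 𝕜 (n + 1 : ℕ) f 0) :
    (fun x => f x - ∑ m ∈ Finset.range (n + 1),
      ((m ! : 𝕜)⁻¹) • iteratedFDeriv 𝕜 m f 0 (fun _ => x)) =O[𝓝 0] fun x => ‖x‖ ^ (n + 1) := by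
  let _ : NormedSpace ℝ E := NormedSpace.restrictScalars ℝ 𝕜 E
  let _ : NormedSpace ℝ F := NormedSpace.restrictScalars ℝ 𝕜 F
  have _ : IsScalarTower ℝ 𝕜 E := ⟨fun r c x => by
    rw [Algebra.smul_def, mul_smul]; rfl⟩
  have _ : IsScalarTower ℝ 𝕜 F := ⟨fun r c x => by
    rw [Algebra.smul_def, mul_smul]; rfl⟩
  exact taylor_isBigO_of_isScalarTower hf

/-- Taylor's formula for a curve. -/
theorem taylor_isBigO_curve {𝕜 F : Type*} [RCLike 𝕜] [NormedAddCommGroup F] [NormedSpace 𝕜 F]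
    [CompleteSpace F] {n : ℕ} {f : 𝕜 → F} (hf : ContDiffAt 𝕜 (n + 1 : ℕ) f 0) :
    (fun x : 𝕜 => f x - ∑ m ∈ Finset.range (n + 1), x ^ m • ((m ! : 𝕜)⁻¹) • iteratedDeriv m f 0)
      =O[𝓝 0] fun x => ‖x‖ ^ (n + 1) := by
  refine (taylor_isBigO hf).congr_left fun x => ?_
  congr 1
  refine Finset.sum_congr rfl fun m _ => ?_
  rw [iteratedFDeriv_apply_eq_iteratedDeriv_mul_prod, Finset.prod_const, Finset.card_univ,
    Fintype.card_fin, smul_comm]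

/-- A polynomial of degree at most `n` which is `O(|x|^{n+1})` vanishes. -/
theorem coeff_eq_zero_of_isBigO {𝕜 F : Type*} [RCLike 𝕜] [NormedAddCommGroup F] [NormedSpace 𝕜 F]
    (n : ℕ) (c : ℕ → F)
    (h : (fun x : 𝕜 => ∑ m ∈ Finset.range n, x ^ m • c m) =O[𝓝[≠] 0] fun x => ‖x‖ ^ n) :
    ∀ m < n, c m = 0 := by
  induction n generalizing c with
  | zero => simp
  | succ n ih =>
    -- The limit at `0` kills the constant coefficient; afterwards the estimate can be divided by
    -- `‖x‖`, which lowers `n`.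
    have h0 : c 0 = 0 := by
      have t1 : Tendsto (fun x : 𝕜 => ∑ m ∈ Finset.range (n + 1), x ^ m • c m) (𝓝[≠] 0)
          (𝓝 (∑ m ∈ Finset.range (n + 1), (0 : 𝕜) ^ m • c m)) := by
        have : Continuous fun x : 𝕜 => ∑ m ∈ Finset.range (n + 1), x ^ m • c m := by fun_prop
        exact (this.tendsto 0).mono_left nhdsWithin_le_nhds
      have t2 : Tendsto (fun x : 𝕜 => ‖x‖ ^ (n + 1)) (𝓝[≠] 0) (𝓝 0) := by
        have : Continuous fun x : 𝕜 => ‖x‖ ^ (n + 1) := by fun_prop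
        simpa using (this.tendsto 0).mono_left nhdsWithin_le_nhds
      have := tendsto_nhds_unique t1 (h.trans_tendsto t2)
      rw [Finset.sum_range_succ'] at this
      simpa using this
    have h1 := ih (fun m => c (m + 1)) (by
      obtain ⟨K, hK⟩ := h.bound
      refine IsBigO.of_bound K ?_
      filter_upwards [hK, self_mem_nhdsWithin] with x hx hx0
      have hx0' : 0 < ‖x‖ := norm_pos_iff.2 hx0
      rw [Finset.sum_range_succ', h0, smul_zero, add_zero] at hx
      simp only [pow_succ' x, mul_smul, ← Finset.smul_sum] at hx
      rw [norm_smul, norm_pow, norm_norm, pow_succ', mul_left_comm] at hx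
      simpa using le_of_mul_le_mul_left hx hx0')
    intro m hm
    cases m with
    | zero => exact h0
    | succ m => exact h1 m (by omega)

/-- Taylor's formula with a continuous remainder. -/
theorem exists_taylor_remainder {𝕜 F : Type*} [RCLike 𝕜] [NormedAddCommGroup F] [NormedSpace 𝕜 F]
    [CompleteSpace F] {n : ℕ} {f : 𝕜 → F} (hf : ContDiffAt 𝕜 (n + 1 : ℕ) f 0) :
    ∃ R : 𝕜 → F, (∀ᶠ x in 𝓝 (0 : 𝕜), ContinuousAt R x) ∧ ∀ x : 𝕜,
      f x = ∑ m ∈ Finset.range n, x ^ m • ((m ! : 𝕜)⁻¹) • iteratedDeriv m f 0 + x ^ n • R x := by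
  classical
  set c : ℕ → F := fun m => ((m ! : 𝕜)⁻¹) • iteratedDeriv m f 0 with hc
  have hcf : ∀ᶠ x in 𝓝 (0 : 𝕜), ContinuousAt f x :=
    (hf.eventually (by simp)).mono fun x hx => hx.continuousAt
  set g : 𝕜 → F := fun x => (x ^ n)⁻¹ • (f x - ∑ m ∈ Finset.range n, x ^ m • c m) with hg
  -- Away from the origin the remainder is forced to be the quotient `g`; since `f` is `C^{n+1}`, `g
  -- x - c n = O(‖x‖)`, so `c n` is the continuous value at `0`.
  refine ⟨fun x => if x = 0 then c n else g x, ?_, ?_⟩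
  · filter_upwards [hcf] with x hx
    by_cases hx0 : x = 0
    · subst hx0
      obtain ⟨K, hK⟩ := (taylor_isBigO_curve hf).bound
      rw [ContinuousAt, if_pos rfl, tendsto_iff_norm_sub_tendsto_zero]
      refine squeeze_zero' (g := fun x => K * ‖x‖) (Eventually.of_forall fun _ => norm_nonneg _) ?_ ?_
      · filter_upwards [hK] with x hx
        by_cases hx0 : x = 0
        · simp [hx0]
        · have hp : 0 < ‖x‖ := norm_pos_iff.2 hx0
          rw [if_neg hx0]
          have e : g x - c n = (x ^ n)⁻¹ • (f x - ∑ m ∈ Finset.range (n + 1), x ^ m • c m) := by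
            rw [Finset.sum_range_succ, ← sub_sub, smul_sub (x ^ n)⁻¹ _ (x ^ n • c n),
              inv_smul_smul₀ (pow_ne_zero n hx0)]
          rw [e, norm_smul, norm_inv, norm_pow, inv_mul_le_iff₀ (pow_pos hp n)]
          rw [norm_pow, norm_norm, pow_succ] at hx
          linarith
      · have : Continuous fun x : 𝕜 => K * ‖x‖ := by fun_prop
        simpa using this.tendsto 0
    · have h1 : ContinuousAt g x := by
        have : x ^ n ≠ 0 := pow_ne_zero n hx0
        fun_prop (disch := assumption)
      refine h1.congr ?_
      filter_upwards [isOpen_ne.mem_nhds hx0] with y hy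
      rw [if_neg hy]
  · intro x
    by_cases hx0 : x = 0
    · subst hx0
      cases n with
      | zero => simp [hc]
      | succ n => rw [Finset.sum_range_succ']; simp [hc]
    · simp only [if_neg hx0, hg]
      rw [smul_inv_smul₀ (pow_ne_zero n hx0)]
      abel

end Taylor

/-! ### Taylor coefficients of `g ∘ z₀`. -/

section Composition

theorem isBigO_pow_of_le {𝕜 : Type*} [RCLike 𝕜] {a b : ℕ} (h : a ≤ b) :
    (fun ε : 𝕜 => ‖ε‖ ^ b) =O[𝓝 0] fun ε : 𝕜 => ‖ε‖ ^ a := by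
  refine IsBigO.of_bound 1 ?_
  filter_upwards [Metric.ball_mem_nhds (0 : 𝕜) one_pos] with ε hε
  rw [mem_ball_zero_iff] at hε
  rw [norm_pow, norm_pow, norm_norm, one_mul]
  exact pow_le_pow_of_le_one (norm_nonneg _) hε.le h

theorem isBigO_pow_smul {𝕜 F : Type*} [RCLike 𝕜] [NormedAddCommGroup F] [NormedSpace 𝕜 F]
    {a b : ℕ} (h : a ≤ b) (c : F) :
    (fun ε : 𝕜 => ε ^ b • c) =O[𝓝 0] fun ε : 𝕜 => ‖ε‖ ^ a := by
  refine IsBigO.trans (g := fun ε : 𝕜 => ‖ε‖ ^ b) ?_ (isBigO_pow_of_le h)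
  refine IsBigO.of_bound ‖c‖ (Eventually.of_forall fun ε => ?_)
  rw [norm_smul, norm_pow, norm_pow, norm_norm, mul_comm]

theorem isBigO_sum_smul {𝕜 F ι : Type*} [RCLike 𝕜] [NormedAddCommGroup F] [NormedSpace 𝕜 F]
    (s : Finset ι) (c : ι → 𝕜) {f : ι → 𝕜 → F} {b : 𝕜 → ℝ} {l : Filter 𝕜}
    (h : ∀ m ∈ s, f m =O[l] b) : (fun ε => ∑ m ∈ s, c m • f m ε) =O[l] b :=
  IsBigO.fun_sum fun m hm => (h m hm).const_smul_left (c m)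

theorem multilinear_diag_sum {𝕜 E H : Type*} [RCLike 𝕜] [NormedAddCommGroup E]
    [NormedSpace 𝕜 E] [NormedAddCommGroup H] [NormedSpace 𝕜 H] {i m : ℕ} (M : ContinuousMultilinearMap 𝕜 (fun _ : Fin m => E) H)
    (ζ : ℕ → E) (ε : 𝕜) :
    M (fun _ => ∑ t : Fin i, ε ^ ((t : ℕ) + 1) • ζ ((t : ℕ) + 1)) =
      ∑ t : Fin m → Fin i, ε ^ (∑ a, ((t a : ℕ) + 1)) • M (fun a => ζ ((t a : ℕ) + 1)) := by
  classical
  rw [ContinuousMultilinearMap.map_sum]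
  refine Finset.sum_congr rfl fun t _ => ?_
  rw [ContinuousMultilinearMap.map_smul_univ, Finset.prod_pow_eq_pow_sum]

variable {𝕜 E H : Type*} [RCLike 𝕜] [NormedAddCommGroup E] [NormedSpace 𝕜 E]
  [NormedAddCommGroup H] [NormedSpace 𝕜 H]

/-- Replacing `x` by `p` costs `O(ε^{i+1})` in one slot, and each of the other `m - 1` slots
contributes a factor `O(ε)`. To order `i + 1` the coefficient `b` is therefore visible only in the
linear term `m = 1`. -/
theorem multilinear_diag_sub_isBigO {x p : 𝕜 → E} {i : ℕ} {b : E} (m : ℕ)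
    (M : ContinuousMultilinearMap 𝕜 (fun _ : Fin m => E) H)
    (hx : x =O[𝓝 0] fun ε : 𝕜 => ‖ε‖) (hp : p =O[𝓝 0] fun ε : 𝕜 => ‖ε‖)
    (hxp : (fun ε => x ε - p ε - ε ^ (i + 1) • b) =O[𝓝 0] fun ε : 𝕜 => ‖ε‖ ^ (i + 2)) :
    (fun ε => M (fun _ => x ε) - M (fun _ => p ε) -
      if m = 1 then ε ^ (i + 1) • M (fun _ => b) else 0) =O[𝓝 0] fun ε : 𝕜 => ‖ε‖ ^ (i + 2) := by
  have hd : (fun ε => x ε - p ε) =O[𝓝 0] fun ε : 𝕜 => ‖ε‖ ^ (i + 1) := by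
    have := (hxp.trans (isBigO_pow_of_le (Nat.le_succ (i + 1)))).add
      (isBigO_pow_smul (le_refl (i + 1)) b)
    simpa using this
  match m, M with
  | 0, M =>
    have : ∀ ε, (fun _ : Fin 0 => x ε) = fun _ => p ε := fun ε => Subsingleton.elim _ _
    simp [this, isBigO_zero]
  | 1, M =>
    have e : ∀ ε, M (fun _ => x ε) - M (fun _ => p ε) - ε ^ (i + 1) • M (fun _ => b)
        = M (fun _ => x ε - p ε - ε ^ (i + 1) • b) := by
      intro ε
      have h1 : ∀ y : E, (fun _ : Fin 1 => y) = Function.update (fun _ : Fin 1 => (0 : E)) 0 y :=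
        fun y => by
          ext a
          rw [Subsingleton.elim a 0, Function.update_self]
      rw [h1 (x ε), h1 (p ε), h1 b, h1 (x ε - p ε - ε ^ (i + 1) • b),
        ContinuousMultilinearMap.map_update_sub, ContinuousMultilinearMap.map_update_sub,
        ContinuousMultilinearMap.map_update_smul]
    simp only [if_true, e]
    obtain ⟨K, hK⟩ := hxp.bound
    refine IsBigO.of_bound (‖M‖ * K) ?_
    filter_upwards [hK] with ε hε
    refine (M.le_opNorm _).trans ?_
    simp only [Finset.univ_unique, Finset.prod_const, Finset.card_singleton, pow_one]
    rw [mul_assoc]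
    gcongr
  | m + 2, M =>
    have hm : m + 2 ≠ 1 := by omega
    simp only [if_neg hm, sub_zero]
    obtain ⟨K, hK⟩ := hd.bound
    obtain ⟨A, hA⟩ := hx.bound
    obtain ⟨B, hB⟩ := hp.bound
    set D := max A B
    have : (fun ε => M (fun _ => x ε) - M (fun _ => p ε)) =O[𝓝 0]
        fun ε : 𝕜 => ‖ε‖ ^ (m + 1 + (i + 1)) := by
      refine IsBigO.of_bound (‖M‖ * (m + 2 : ℕ) * D ^ (m + 1) * K) ?_
      filter_upwards [hK, hA, hB] with ε h1 h2 h3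
      have h := M.norm_image_sub_le (fun _ => x ε) (fun _ => p ε)
      rw [Fintype.card_fin] at h
      refine h.trans ?_
      have e1 : ‖(fun _ : Fin (m + 2) => x ε)‖ = ‖x ε‖ := pi_norm_const _
      have e2 : ‖(fun _ : Fin (m + 2) => p ε)‖ = ‖p ε‖ := pi_norm_const _
      have e3 : ‖(fun _ : Fin (m + 2) => x ε) - fun _ => p ε‖ = ‖x ε - p ε‖ :=
        pi_norm_const (x ε - p ε)
      rw [e1, e2, e3]
      rw [norm_norm] at h2 h3
      rw [norm_pow, norm_norm] at h1
      have h4 : max ‖x ε‖ ‖p ε‖ ≤ D * ‖ε‖ := max_le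
        (h2.trans (by gcongr; exact le_max_left _ _)) (h3.trans (by gcongr; exact le_max_right _ _))
      rw [norm_pow, norm_norm, pow_add]
      calc ‖M‖ * ((m + 2 : ℕ) : ℝ) * max ‖x ε‖ ‖p ε‖ ^ (m + 2 - 1) * ‖x ε - p ε‖
          ≤ ‖M‖ * ((m + 2 : ℕ) : ℝ) * (D * ‖ε‖) ^ (m + 1) * (K * ‖ε‖ ^ (i + 1)) := by
            have hD : 0 ≤ D * ‖ε‖ := (norm_nonneg _).trans ((le_max_left _ _).trans h4)
            have h5 : max ‖x ε‖ ‖p ε‖ ^ (m + 2 - 1) ≤ (D * ‖ε‖) ^ (m + 1) :=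
              pow_le_pow_left₀ ((norm_nonneg _).trans (le_max_left _ _)) h4 _
            exact mul_le_mul (mul_le_mul_of_nonneg_left h5 (by positivity)) h1 (norm_nonneg _)
              (mul_nonneg (by positivity) (pow_nonneg hD _))
        _ = _ := by rw [mul_pow]; ring
    exact this.trans (isBigO_pow_of_le (by omega))

/-- The coefficient of `ε^v` in the expansion of `g (z₀ ε)`. -/
noncomputable def compCoeff (𝕜 : Type*) {E H : Type*} [RCLike 𝕜] [NormedAddCommGroup E]
    [NormedSpace 𝕜 E] [NormedAddCommGroup H] [NormedSpace 𝕜 H] (g : E → H) (ζ : ℕ → E)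
    (i v : ℕ) : H :=
  ∑ m ∈ Finset.range (2 * (i + 1)), ((m ! : 𝕜)⁻¹) •
    ∑ t : Fin m → Fin i with (∑ a, ((t a : ℕ) + 1)) = v,
      iteratedFDeriv 𝕜 m g 0 (fun a => ζ ((t a : ℕ) + 1))

variable [CompleteSpace E] [CompleteSpace H]

/-- Three errors are of order `i + 2`: the Taylor remainder of `g`, the replacement of `z₀` by the
polynomial `p` of degree `i` (corrected in the linear term), and the monomials of weight at least `i
+ 2`. The top coefficient `ζ (i + 1)` is kept apart because the recursion for `S̄` treats it in a
separate summand; the range `2 * (i + 1)` is the one in `W`. -/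
theorem comp_expansion_isBigO {g : E → H} {z₀ : 𝕜 → E} {i : ℕ}
    (hg : ContDiffAt 𝕜 (2 * (i + 1) : ℕ) g 0) (hz : ContDiffAt 𝕜 (i + 2 : ℕ) z₀ 0)
    (hz0 : z₀ 0 = 0) {ζ : ℕ → E} (hζ : ∀ j, ζ j = ((j ! : 𝕜)⁻¹) • curveCoeff z₀ j) :
    (fun ε => g (z₀ ε) - ∑ v ∈ Finset.range (i + 2), ε ^ v • (compCoeff 𝕜 g ζ i v +
      if v = i + 1 then iteratedFDeriv 𝕜 1 g 0 (fun _ => ζ (i + 1)) else 0))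
      =O[𝓝 0] fun ε : 𝕜 => ‖ε‖ ^ (i + 2) := by
  classical
  set p : 𝕜 → E := fun ε => ∑ t : Fin i, ε ^ ((t : ℕ) + 1) • ζ ((t : ℕ) + 1) with hpdef
  have hxp : (fun ε => z₀ ε - p ε - ε ^ (i + 1) • ζ (i + 1)) =O[𝓝 0]
      fun ε : 𝕜 => ‖ε‖ ^ (i + 2) := by
    refine (taylor_isBigO_curve (n := i + 1) hz).congr_left fun ε => ?_
    rw [Finset.sum_range_succ, Finset.sum_range_succ', sub_sub]
    congr 1
    simp only [hpdef, hζ, curveCoeff, iteratedDeriv_zero, hz0, smul_zero, add_zero]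
    rw [Finset.sum_range (fun t => ε ^ (t + 1) • ((t + 1)! : 𝕜)⁻¹ • iteratedDeriv (t + 1) z₀ 0)]
  have hp : p =O[𝓝 0] fun ε : 𝕜 => ‖ε‖ := by
    refine IsBigO.fun_sum fun t _ => ?_
    simpa using isBigO_pow_smul (𝕜 := 𝕜) (a := 1) (b := (t : ℕ) + 1) (by omega) (ζ ((t : ℕ) + 1))
  have hx : z₀ =O[𝓝 0] fun ε : 𝕜 => ‖ε‖ := by
    have h1 := (hxp.trans (isBigO_pow_of_le (a := 1) (by omega))).add
      (isBigO_pow_smul (𝕜 := 𝕜) (a := 1) (b := i + 1) (by omega) (ζ (i + 1)))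
    have h2 := h1.add (by simpa using hp)
    simpa using h2
  have hzc : Tendsto z₀ (𝓝 0) (𝓝 0) := by
    simpa [hz0] using hz.continuousAt.tendsto
  have t1 : (fun ε => g (z₀ ε) - ∑ m ∈ Finset.range (2 * (i + 1)),
      ((m ! : 𝕜)⁻¹) • iteratedFDeriv 𝕜 m g 0 (fun _ => z₀ ε)) =O[𝓝 0]
      fun ε : 𝕜 => ‖ε‖ ^ (i + 2) := by
    have h1 := (taylor_isBigO (n := 2 * i + 1) hg).comp_tendsto hzc
    have h2 : (fun ε => ‖z₀ ε‖ ^ (2 * i + 1 + 1)) =O[𝓝 0] fun ε : 𝕜 => ‖ε‖ ^ (2 * i + 1 + 1) :=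
      hx.norm_left.pow _
    exact (h1.trans h2).trans (isBigO_pow_of_le (by omega))
  have t2 : (fun ε => ∑ m ∈ Finset.range (2 * (i + 1)), ((m ! : 𝕜)⁻¹) •
      (iteratedFDeriv 𝕜 m g 0 (fun _ => z₀ ε) - iteratedFDeriv 𝕜 m g 0 (fun _ => p ε) -
        if m = 1 then ε ^ (i + 1) • iteratedFDeriv 𝕜 m g 0 (fun _ => ζ (i + 1)) else 0))
      =O[𝓝 0] fun ε : 𝕜 => ‖ε‖ ^ (i + 2) :=
    isBigO_sum_smul _ _ fun m _ => multilinear_diag_sub_isBigO m _ hx hp hxp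
  have t3 : (fun ε : 𝕜 => ∑ m ∈ Finset.range (2 * (i + 1)), ((m ! : 𝕜)⁻¹) •
      ∑ t : Fin m → Fin i, if i + 2 ≤ ∑ a, ((t a : ℕ) + 1) then
        ε ^ (∑ a, ((t a : ℕ) + 1)) • iteratedFDeriv 𝕜 m g 0 (fun a => ζ ((t a : ℕ) + 1)) else 0)
      =O[𝓝 0] fun ε : 𝕜 => ‖ε‖ ^ (i + 2) := by
    refine isBigO_sum_smul _ _ fun m _ => IsBigO.fun_sum fun t _ => ?_
    split_ifs with h
    · exact isBigO_pow_smul h _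
    · exact isBigO_zero _ _
  refine ((t1.add t2).add t3).congr_left fun ε => ?_
  have e1 : ∑ m ∈ Finset.range (2 * (i + 1)), ((m ! : 𝕜)⁻¹) •
      (if m = 1 then ε ^ (i + 1) • iteratedFDeriv 𝕜 m g 0 (fun _ => ζ (i + 1)) else 0) =
      ε ^ (i + 1) • iteratedFDeriv 𝕜 1 g 0 (fun _ => ζ (i + 1)) := by
    rw [Finset.sum_eq_single_of_mem 1 (Finset.mem_range.2 (by omega))]
    · simp
    · intro m _ hm
      simp [hm]
  have e2 : ∀ m, iteratedFDeriv 𝕜 m g 0 (fun _ => p ε) =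
      (∑ v ∈ Finset.range (i + 2), ε ^ v • ∑ t : Fin m → Fin i with (∑ a, ((t a : ℕ) + 1)) = v,
        iteratedFDeriv 𝕜 m g 0 (fun a => ζ ((t a : ℕ) + 1))) +
      ∑ t : Fin m → Fin i, if i + 2 ≤ ∑ a, ((t a : ℕ) + 1) then
        ε ^ (∑ a, ((t a : ℕ) + 1)) • iteratedFDeriv 𝕜 m g 0 (fun a => ζ ((t a : ℕ) + 1)) else 0 := by
    intro m
    rw [hpdef, multilinear_diag_sum]
    simp only [Finset.smul_sum, Finset.sum_filter]
    rw [Finset.sum_comm, ← Finset.sum_add_distrib]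
    refine Finset.sum_congr rfl fun t _ => ?_
    by_cases h : i + 2 ≤ ∑ a, ((t a : ℕ) + 1)
    · rw [if_pos h]
      symm
      rw [add_eq_right]
      refine Finset.sum_eq_zero fun v hv => ?_
      rw [if_neg]
      · exact smul_zero _
      · have := Finset.mem_range.1 hv
        omega
    · simp only [smul_ite, smul_zero]
      rw [if_neg h, add_zero, Finset.sum_ite_eq, if_pos (Finset.mem_range.2 (by omega))]
  have e3 : ∑ v ∈ Finset.range (i + 2), ε ^ v • (compCoeff 𝕜 g ζ i v +
      if v = i + 1 then iteratedFDeriv 𝕜 1 g 0 (fun _ => ζ (i + 1)) else 0) =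
      (∑ m ∈ Finset.range (2 * (i + 1)), ((m ! : 𝕜)⁻¹) • ∑ v ∈ Finset.range (i + 2), ε ^ v •
        ∑ t : Fin m → Fin i with (∑ a, ((t a : ℕ) + 1)) = v,
          iteratedFDeriv 𝕜 m g 0 (fun a => ζ ((t a : ℕ) + 1))) +
      ε ^ (i + 1) • iteratedFDeriv 𝕜 1 g 0 (fun _ => ζ (i + 1)) := by
    simp only [smul_add]
    rw [Finset.sum_add_distrib]
    congr 1
    swap
    · simp only [smul_ite, smul_zero]
      rw [Finset.sum_ite_eq', if_pos (Finset.mem_range.2 (by omega))]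
    simp only [compCoeff, Finset.smul_sum]
    rw [Finset.sum_comm]
    refine Finset.sum_congr rfl fun m _ => Finset.sum_congr rfl fun v _ =>
      Finset.sum_congr rfl fun t _ => smul_comm _ _ _
  simp only [smul_sub, Finset.sum_sub_distrib, e1, e3]
  simp only [e2, smul_add, Finset.sum_add_distrib]
  abel

/-- The Taylor coefficients of `g ∘ z₀` at the origin. -/
theorem iteratedDeriv_comp_curve {g : E → H} {z₀ : 𝕜 → E} {i : ℕ}
    (hg : ContDiffAt 𝕜 (2 * (i + 1) : ℕ) g 0) (hz : ContDiffAt 𝕜 (i + 2 : ℕ) z₀ 0)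
    (hz0 : z₀ 0 = 0) {ζ : ℕ → E} (hζ : ∀ j, ζ j = ((j ! : 𝕜)⁻¹) • curveCoeff z₀ j)
    {v : ℕ} (hv : v ≤ i + 1) :
    ((v ! : 𝕜)⁻¹) • iteratedDeriv v (fun ε => g (z₀ ε)) 0 = compCoeff 𝕜 g ζ i v +
      if v = i + 1 then iteratedFDeriv 𝕜 1 g 0 (fun _ => ζ (i + 1)) else 0 := by
  have hgz : ContDiffAt 𝕜 (i + 1 + 1 : ℕ) (fun ε => g (z₀ ε)) 0 := by
    refine ContDiffAt.comp (g := g) (0 : 𝕜) ?_ hz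
    rw [hz0]
    exact hg.of_le (by exact_mod_cast (by omega : i + 2 ≤ 2 * (i + 1)))
  have h := (comp_expansion_isBigO hg hz hz0 hζ).sub (taylor_isBigO_curve hgz)
  rw [← sub_eq_zero]
  refine coeff_eq_zero_of_isBigO (𝕜 := 𝕜) (i + 2) (fun v => ((v ! : 𝕜)⁻¹) •
    iteratedDeriv v (fun ε => g (z₀ ε)) 0 - (compCoeff 𝕜 g ζ i v +
      if v = i + 1 then iteratedFDeriv 𝕜 1 g 0 (fun _ => ζ (i + 1)) else 0)) ?_ v (by omega)
  refine (h.mono nhdsWithin_le_nhds).congr_left fun ε => ?_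
  simp only [smul_sub, Finset.sum_sub_distrib]
  abel

end Composition

/-! ### The operator matrices `M^{2k+1}` without their factorials. -/

section ChainCoefficients

variable {𝕜 E F : Type*} [RCLike 𝕜] [NormedAddCommGroup E] [NormedSpace 𝕜 E]
  [NormedAddCommGroup F] [NormedSpace 𝕜 F]

/-- The weight `m! / (2m)!`. -/
noncomputable def wt (𝕜 : Type*) [RCLike 𝕜] (m : ℕ) : 𝕜 := (m ! : 𝕜) / ((2 * m)! : 𝕜)

theorem factorial_cast_ne_zero (𝕜 : Type*) [RCLike 𝕜] (m : ℕ) : (m ! : 𝕜) ≠ 0 :=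
  Nat.cast_ne_zero.2 m.factorial_ne_zero

theorem wt_ne_zero (m : ℕ) : wt 𝕜 m ≠ 0 :=
  div_ne_zero (factorial_cast_ne_zero 𝕜 _) (factorial_cast_ne_zero 𝕜 _)

@[simp]
theorem wt_zero : wt 𝕜 0 = 1 := by simp [wt]

theorem Eop_self (Sb : ℕ → E →L[𝕜] F) (T : ℕ → F →L[𝕜] E) (i : ℕ) :
    Eop Sb T i i = ContinuousLinearMap.id 𝕜 E := by
  rw [Eop, if_pos rfl]

theorem Eop_of_gt (Sb : ℕ → E →L[𝕜] F) (T : ℕ → F →L[𝕜] E) {i j : ℕ} (h : j < i) :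
    Eop Sb T i j = 0 := by
  rw [Eop, if_neg (by omega), if_neg (by omega)]

theorem Eop_of_lt (Sb : ℕ → E →L[𝕜] F) (T : ℕ → F →L[𝕜] E) {i j : ℕ} (h : i < j) :
    Eop Sb T i j = -((T i) ∘L ∑ v ∈ Finset.Ico (i + 1) (j + 1), (Sb v) ∘L (Eop Sb T v j)) := by
  rw [Eop, if_neg (by omega), if_pos h,
    Finset.sum_Ico_eq_sum_range (fun v => (Sb v) ∘L (Eop Sb T v j)), Finset.sum_range]
  have : j + 1 - (i + 1) = j - i := by omega
  rw [this]

theorem Eop_congr {Sb Sb' : ℕ → E →L[𝕜] F} (T : ℕ → F →L[𝕜] E) {j : ℕ}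
    (h : ∀ v ≤ j, Sb v = Sb' v) (i : ℕ) : Eop Sb T i j = Eop Sb' T i j := by
  induction hd : j - i using Nat.strong_induction_on generalizing i with
  | _ d ih =>
    rcases lt_trichotomy i j with hij | rfl | hij
    · rw [Eop_of_lt _ _ hij, Eop_of_lt _ _ hij]
      congr 2
      refine Finset.sum_congr rfl fun v hv => ?_
      rw [Finset.mem_Ico] at hv
      rw [h v (by omega), ih (j - v) (by omega) v rfl]
    · rw [Eop_self, Eop_self]
    · rw [Eop_of_gt _ _ hij, Eop_of_gt _ _ hij]

/-- In this form `n!` cancels on conjugation by `C^n`, and the remaining factor splits into one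
depending on `n` and the weights `wt`, which do not. -/
theorem cNum_eq {n l : ℕ} (hl : 1 ≤ l) (hln : l ≤ n + 1) :
    cNum 𝕜 n l = (n ! : 𝕜) / ((n + 1 - l)! : 𝕜) * wt 𝕜 (l - 1) := by
  obtain ⟨m, rfl⟩ : ∃ m, l = m + 1 := ⟨l - 1, by omega⟩
  have hm : m ≤ n := by omega
  rw [cNum, wt, Nat.add_sub_cancel, Nat.cast_choose 𝕜 hm,
    Nat.cast_choose 𝕜 (by omega : m ≤ 2 * m), show n + 1 - (m + 1) = n - m by omega,
    show 2 * m - m = m by omega]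
  have h1 := factorial_cast_ne_zero 𝕜 m
  have h2 := factorial_cast_ne_zero 𝕜 (n - m)
  have h3 := factorial_cast_ne_zero 𝕜 (2 * m)
  field_simp

theorem Ec_eq (Sb : ℕ → E →L[𝕜] F) (T : ℕ → F →L[𝕜] E) {n i j : ℕ} (hi : 1 ≤ i) (hin : i ≤ n + 1)
    (hj : 1 ≤ j) (hjn : j ≤ n + 1) :
    Ec Sb T n i j = (((n + 1 - i)! : 𝕜) / ((n + 1 - j)! : 𝕜) * (wt 𝕜 (j - 1) / wt 𝕜 (i - 1))) •
      Eop Sb T i j := by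
  rw [Ec, cNum_eq hi hin, cNum_eq hj hjn]
  congr 1
  have h1 := factorial_cast_ne_zero 𝕜 n
  have h2 := factorial_cast_ne_zero 𝕜 (n + 1 - i)
  have h3 := factorial_cast_ne_zero 𝕜 (n + 1 - j)
  have h4 := wt_ne_zero (𝕜 := 𝕜) (i - 1)
  field_simp

/-- The coefficient operators of the Jordan chains: `chainCoeff i k` is the coefficient of
`ε^(k-i)` of the chain polynomial of order `k`. -/
noncomputable def chainCoeff (Sb : ℕ → E →L[𝕜] F) (T : ℕ → F →L[𝕜] E) : ℕ → ℕ → E →L[𝕜] E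
  | 0, k => if k = 0 then ContinuousLinearMap.id 𝕜 E else 0
  | i + 1, k => ∑ m ∈ Finset.range k,
      (wt 𝕜 (k - 1) / wt 𝕜 m) • (chainCoeff Sb T i m) ∘L (Eop Sb T (m + 1) k)

variable (Sb : ℕ → E →L[𝕜] F) (T : ℕ → F →L[𝕜] E)

@[simp]
theorem chainCoeff_zero_zero : chainCoeff Sb T 0 0 = ContinuousLinearMap.id 𝕜 E := by
  simp [chainCoeff]

theorem chainCoeff_zero_of_pos {k : ℕ} (hk : k ≠ 0) : chainCoeff Sb T 0 k = 0 := by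
  simp [chainCoeff, hk]

theorem chainCoeff_succ (i k : ℕ) : chainCoeff Sb T (i + 1) k = ∑ m ∈ Finset.range k,
    (wt 𝕜 (k - 1) / wt 𝕜 m) • (chainCoeff Sb T i m) ∘L (Eop Sb T (m + 1) k) := by
  rw [chainCoeff]

theorem chainCoeff_of_gt {i k : ℕ} (h : k < i) : chainCoeff Sb T i k = 0 := by
  induction i generalizing k with
  | zero => omega
  | succ i ih =>
    rw [chainCoeff_succ]
    refine Finset.sum_eq_zero fun m hm => ?_
    rw [ih (by have := Finset.mem_range.1 hm; omega), ContinuousLinearMap.zero_comp, smul_zero]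

theorem chainCoeff_self (k : ℕ) : chainCoeff Sb T k k = ContinuousLinearMap.id 𝕜 E := by
  induction k with
  | zero => simp
  | succ k ih =>
    rw [chainCoeff_succ, Finset.sum_range_succ, Finset.sum_eq_zero, ih, Eop_self,
      Nat.add_sub_cancel, div_self (wt_ne_zero k)]
    · simp
    · intro m hm
      rw [chainCoeff_of_gt _ _ (Finset.mem_range.1 hm), ContinuousLinearMap.zero_comp, smul_zero]

/-- Needed because `Sbar` feeds a truncated sequence into its own recursion. -/
theorem chainCoeff_congr {Sb Sb' : ℕ → E →L[𝕜] F} {i k : ℕ} (h : ∀ v ≤ k, Sb v = Sb' v) :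
    chainCoeff Sb T i k = chainCoeff Sb' T i k := by
  induction i generalizing k with
  | zero => simp [chainCoeff]
  | succ i ih =>
    rw [chainCoeff_succ, chainCoeff_succ]
    refine Finset.sum_congr rfl fun m hm => ?_
    have := Finset.mem_range.1 hm
    rw [ih (fun v hv => h v (by omega)), Eop_congr T h]

theorem chainCoeff_one {j : ℕ} (hj : 1 ≤ j) :
    chainCoeff Sb T 1 j = wt 𝕜 (j - 1) • Eop Sb T 1 j := by
  rw [chainCoeff_succ, Finset.sum_eq_single_of_mem 0 (Finset.mem_range.2 hj)]
  · simp [ContinuousLinearMap.id_comp]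
  · intro m _ hm
    rw [chainCoeff_zero_of_pos _ _ hm, ContinuousLinearMap.zero_comp, smul_zero]

/-- The mechanism behind `M^{2k+1}`: multiplication by the rows of `(C^n)⁻¹ E C^n` below the first
raises the upper index of the chain coefficients by one, since the factors `(n - u)!` cancel and the
weights are those of `chainCoeff_succ`. The terms `u = 0` and `u ≥ v` can be dropped or added
freely: there `chainCoeff` (as `i ≥ 1`) or `Eop` vanishes. -/
theorem sum_chainCoeff_comp_Ec {i N n v : ℕ} (hi : 1 ≤ i) (hv : 1 ≤ v) (hvN : v ≤ N + 1)
    (hNn : N ≤ n) (c : 𝕜) :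
    ∑ u ∈ Finset.Icc 1 N, ((c / ((n - u)! : 𝕜)) • chainCoeff Sb T i u) ∘L (Ec Sb T n (u + 1) v) =
      (c / ((n + 1 - v)! : 𝕜)) • chainCoeff Sb T (i + 1) v := by
  have h0 : chainCoeff Sb T (i + 1) v = ∑ m ∈ Finset.Icc 1 N,
      (wt 𝕜 (v - 1) / wt 𝕜 m) • (chainCoeff Sb T i m) ∘L (Eop Sb T (m + 1) v) := by
    rw [chainCoeff_succ]
    have hsub : Finset.Icc 1 N ⊆ Finset.range (N + 1) := fun u hu => by
      rw [Finset.mem_Icc] at hu; exact Finset.mem_range.2 (by omega)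
    have hsub' : Finset.range v ⊆ Finset.range (N + 1) := Finset.range_mono hvN
    rw [Finset.sum_subset hsub, Finset.sum_subset hsub']
    · intro m _ hm
      rw [Eop_of_gt _ _ (by rw [Finset.mem_range] at hm; omega), ContinuousLinearMap.comp_zero,
        smul_zero]
    · intro m hm hm'
      rw [Finset.mem_range] at hm
      rw [Finset.mem_Icc] at hm'
      rw [chainCoeff_of_gt _ _ (by omega), ContinuousLinearMap.zero_comp, smul_zero]
  rw [h0, Finset.smul_sum]
  refine Finset.sum_congr rfl fun u hu => ?_
  rw [Finset.mem_Icc] at hu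
  rw [Ec_eq Sb T (by omega) (by omega) hv (by omega), ContinuousLinearMap.comp_smul,
    ContinuousLinearMap.smul_comp, smul_smul, smul_smul, Nat.add_sub_cancel,
    show n + 1 - (u + 1) = n - u by omega]
  congr 1
  have h2 := factorial_cast_ne_zero 𝕜 (n - u)
  field_simp

theorem Mop_eq (k i j : ℕ) (hi : 1 ≤ i) (hik : i ≤ k) (hj : 1 ≤ j) (hjk : j ≤ k) :
    Mop Sb T k i j =
      (((2 * k + 1 - i)! : 𝕜) / ((2 * k + 1 - j)! : 𝕜)) • chainCoeff Sb T i j := by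
  induction k using Nat.strong_induction_on generalizing i j with
  | _ k ih =>
    match k, i with
    | 0, _ => omega
    | 1, i =>
      obtain rfl : i = 1 := by omega
      obtain rfl : j = 1 := by omega
      rw [Mop, if_pos rfl, chainCoeff_self, div_self (factorial_cast_ne_zero 𝕜 _), one_smul]
    | k + 2, 1 =>
      rw [Mop, Ec_eq Sb T le_rfl (by omega) hj (by omega), chainCoeff_one _ _ hj, smul_smul]
      simp
    | k + 2, 2 =>
      rw [Mop]
      have : ∀ v ∈ Finset.Icc 1 (k + 1),
          (Ec Sb T (2 * (k + 2) - 1) 1 v) ∘L (Ec Sb T (2 * (k + 2)) (v + 1) j) =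
          ((((2 * (k + 2) - 1)! : 𝕜) / ((2 * (k + 2) - v)! : 𝕜)) • chainCoeff Sb T 1 v) ∘L
            (Ec Sb T (2 * (k + 2)) (v + 1) j) := by
        intro v hv
        rw [Finset.mem_Icc] at hv
        rw [Ec_eq Sb T le_rfl (by omega) hv.1 (by omega), chainCoeff_one _ _ hv.1, smul_smul,
          show 2 * (k + 2) - 1 + 1 - v = 2 * (k + 2) - v by omega]
        simp
      rw [Finset.sum_congr rfl this, sum_chainCoeff_comp_Ec Sb T le_rfl hj hjk (by omega)]
      rfl
    | k + 2, i + 3 =>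
      -- Summing over `u` first contracts the induction hypothesis with `A^{2k-1}`; the sum over `v`
      -- is the second contraction. Each raises the row index by one, from `i + 1` to `i + 3`.
      rw [Mop, Finset.sum_comm]
      have : ∀ v ∈ Finset.Icc 1 (k + 1), ∑ u ∈ Finset.Icc 1 (k + 1),
          (Mop Sb T (k + 1) (i + 1) u) ∘L (Ec Sb T (2 * (k + 2) - 1) (u + 1) v) ∘L
            (Ec Sb T (2 * (k + 2)) (v + 1) j) =
          ((((2 * (k + 2) - 2 - i)! : 𝕜) / ((2 * (k + 2) - v)! : 𝕜)) •
            chainCoeff Sb T (i + 2) v) ∘L (Ec Sb T (2 * (k + 2)) (v + 1) j) := by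
        intro v hv
        rw [Finset.mem_Icc] at hv
        have e := sum_chainCoeff_comp_Ec Sb T (i := i + 1) (N := k + 1) (n := 2 * (k + 2) - 1)
          (v := v) (by omega) hv.1 (by omega) (by omega) ((2 * (k + 2) - 2 - i)! : 𝕜)
        rw [show 2 * (k + 2) - 1 + 1 - v = 2 * (k + 2) - v by omega] at e
        rw [← e, ContinuousLinearMap.finsetSum_comp]
        refine Finset.sum_congr rfl fun u hu => ?_
        rw [Finset.mem_Icc] at hu
        rw [ih (k + 1) (by omega) (i + 1) u (by omega) (by omega) hu.1 hu.2,
          ContinuousLinearMap.comp_assoc,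
          show 2 * (k + 1) + 1 - (i + 1) = 2 * (k + 2) - 2 - i by omega,
          show 2 * (k + 1) + 1 - u = 2 * (k + 2) - 1 - u by omega]
      rw [Finset.sum_congr rfl this, sum_chainCoeff_comp_Ec Sb T (by omega) hj hjk (by omega),
        show 2 * (k + 2) + 1 - (i + 3) = 2 * (k + 2) - 2 - i by omega]

theorem Xcol_eq {k v : ℕ} (hk : 2 ≤ k) (hv : 1 ≤ v) (hvk : v ≤ k) :
    Xcol Sb T k v = (((2 * k - v)! : 𝕜) / (k ! : 𝕜)) • chainCoeff Sb T v k := by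
  rw [Xcol]
  split_ifs with h
  · subst h
    rw [Ec_eq Sb T le_rfl (by omega) (by omega) (by omega), chainCoeff_one _ _ (by omega),
      smul_smul, show 2 * k - 1 + 1 - k = k by omega]
    simp
  · obtain ⟨w, rfl⟩ : ∃ w, v = w + 1 := ⟨v - 1, by omega⟩
    have e := sum_chainCoeff_comp_Ec Sb T (i := w) (N := k - 1) (n := 2 * k - 1)
      (v := k) (by omega) (by omega) (by omega) (by omega) ((2 * k - (w + 1))! : 𝕜)
    rw [show 2 * k - 1 + 1 - k = k by omega] at e
    rw [← e]
    refine Finset.sum_congr rfl fun u hu => ?_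
    rw [Finset.mem_Icc] at hu
    rw [Nat.add_sub_cancel, Mop_eq Sb T (k - 1) w u (by omega) (by omega) hu.1 hu.2,
      show 2 * (k - 1) + 1 - w = 2 * k - (w + 1) by omega,
      show 2 * (k - 1) + 1 - u = 2 * k - 1 - u by omega]

end ChainCoefficients

/-! ### The operators `S̄_{j+1}` as coefficients of a product expansion. -/

section LeadingOperators

variable {𝕜 E F : Type*} [RCLike 𝕜] [NormedAddCommGroup E] [NormedSpace 𝕜 E] [CompleteSpace E]
  [NormedAddCommGroup F] [NormedSpace 𝕜 F] [CompleteSpace F]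

/-- The Taylor coefficient of order `v` of a curve at the origin. -/
noncomputable def taylorCoeff {H : Type*} [NormedAddCommGroup H] [NormedSpace 𝕜 H] (L : 𝕜 → H)
    (v : ℕ) : H := ((v ! : 𝕜)⁻¹) • iteratedDeriv v L 0

omit [CompleteSpace E] [CompleteSpace F] in
theorem derivOp_eq (G : E → F) (m : ℕ) (v : Fin m → E) :
    derivOp 𝕜 G m v = iteratedFDeriv 𝕜 m (fderiv 𝕜 G) 0 v := by
  ext x
  rw [derivOp, iteratedFDeriv_succ_eq_comp_right]
  simp

omit [CompleteSpace E] [CompleteSpace F] in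
theorem W_eq (G : E → F) (z : ℕ → E) {i v : ℕ} (hv : v ≤ i + 1) :
    W G z (i + 1) (2 * (i + 1) - v) =
      (((2 * (i + 1))! : 𝕜) / ((2 * (i + 1) - v)! : 𝕜)) •
        compCoeff 𝕜 (fderiv 𝕜 G) (fun j => ((j ! : 𝕜)⁻¹) • z j) i v := by
  rw [W, compCoeff]
  congr 1
  refine Finset.sum_congr rfl fun m _ => ?_
  congr 1
  simp only [derivOp_eq]
  refine Finset.sum_congr ?_ fun t _ => rfl
  ext t
  simp only [Finset.mem_filter, Finset.mem_univ, true_and]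
  constructor <;> intro h <;> omega

/-- In `W_{2j-v}` and the `v`-th entry of the column the factors `(2j - v)!` cancel, leaving the
common factor `(2j)!/j!`, the inverse of `wt j`. The sums in `W` omit the curve coefficient of index
`j`; it occurs only linearly, in `L_j`, and there it meets `chainCoeff j j = id`, so the extra
summand `(2j)!/(j!)² G_0^2 z̄_j` restores it. -/
theorem wt_smul_Sbar {G : E → F} {z₀ : 𝕜 → E} {T : ℕ → F →L[𝕜] E} {j : ℕ}
    (hG : ContDiffAt 𝕜 (2 * j + 2 : ℕ) G 0) (hz : ContDiffAt 𝕜 (j + 2 : ℕ) z₀ 0)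
    (hz0 : z₀ 0 = 0) :
    wt 𝕜 j • Sbar G (curveCoeff z₀) T (j + 1) = ∑ v ∈ Finset.range (j + 1),
      (taylorCoeff (linFamily G z₀) v) ∘L (chainCoeff (Sbar G (curveCoeff z₀) T) T v j) := by
  have hfd : ContDiffAt 𝕜 (2 * j : ℕ) (fderiv 𝕜 G) 0 := hG.fderiv_right (by norm_cast; omega)
  match j with
  | 0 =>
    simp [Sbar, taylorCoeff, linFamily, hz0]
  | 1 =>
    have h1 := iteratedDeriv_comp_curve (g := fderiv 𝕜 G) (i := 0) hfd (hz.of_le (by norm_cast))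
      hz0 (fun _ => rfl) (v := 1) le_rfl
    -- The tuples have entries in `Fin 0`, so only the empty one exists, and its weight is `0`, not
    -- `1`.
    have h2 : compCoeff 𝕜 (fderiv 𝕜 G) (fun j => ((j ! : 𝕜)⁻¹) • curveCoeff z₀ j) 0 1 = 0 := by
      rw [compCoeff]
      refine Finset.sum_eq_zero fun m hm => ?_
      rw [Finset.sum_eq_zero, smul_zero]
      intro t ht
      rw [Finset.mem_filter] at ht
      match m, t, ht with
      | 0, t, ht => simp at ht
      | m + 1, t, ht => exact (t 0).elim0
    rw [Finset.sum_range_succ, Finset.sum_range_one, chainCoeff_self,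
      chainCoeff_zero_of_pos _ _ one_ne_zero, ContinuousLinearMap.comp_zero, zero_add,
      ContinuousLinearMap.comp_id]
    have h3 : taylorCoeff (linFamily G z₀) 1 = derivOp 𝕜 G 1 (fun _ => curveCoeff z₀ 1) := by
      rw [derivOp_eq, taylorCoeff]
      refine h1.trans ?_
      rw [h2]
      simp
    rw [h3, Sbar, smul_smul]
    simp [wt]
  | n + 2 =>
    set z := curveCoeff z₀
    set ζ : ℕ → E := fun j => ((j ! : 𝕜)⁻¹) • z j with hζ
    set Sb := Sbar G z T
    set c : 𝕜 := ((2 * (n + 2))! : 𝕜) / ((n + 2)! : 𝕜) with hc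
    have hc0 : wt 𝕜 (n + 2) * c = 1 := by
      rw [wt, hc]
      have h1 := factorial_cast_ne_zero 𝕜 (n + 2)
      have h2 := factorial_cast_ne_zero 𝕜 (2 * (n + 2))
      field_simp
    have hcoef : ∀ v ≤ n + 2, compCoeff 𝕜 (fderiv 𝕜 G) ζ (n + 1) v =
        taylorCoeff (linFamily G z₀) v -
          if v = n + 2 then derivOp 𝕜 G 1 (fun _ => ζ (n + 2)) else 0 := by
      intro v hv
      rw [eq_sub_iff_add_eq]
      have := iteratedDeriv_comp_curve (g := fderiv 𝕜 G) (i := n + 1) hfd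
        (hz.of_le (by norm_cast; omega)) hz0 (ζ := ζ) (fun _ => rfl) (v := v) hv
      rw [taylorCoeff, derivOp_eq]
      exact this.symm
    have hstep : Sb (n + 2 + 1) = ∑ v ∈ Finset.Icc 1 (n + 2), c •
        (compCoeff 𝕜 (fderiv 𝕜 G) ζ (n + 1) v) ∘L (chainCoeff Sb T v (n + 2)) +
          c • derivOp 𝕜 G 1 (fun _ => ζ (n + 2)) := by
      rw [show Sb (n + 2 + 1) = _ from Sbar.eq_4 G z T n, SbarStep]
      congr 1
      · refine Finset.sum_congr rfl fun v hv => ?_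
        rw [Finset.mem_Icc] at hv
        rw [Xcol_eq _ _ (by omega) hv.1 hv.2, W_eq G z hv.2, ContinuousLinearMap.comp_smul,
          ContinuousLinearMap.smul_comp, smul_smul]
        congr 1
        · have h2 := factorial_cast_ne_zero 𝕜 (2 * (n + 2) - v)
          have h3 := factorial_cast_ne_zero 𝕜 (2 * (n + 1 + 1) - v)
          rw [hc]
          field_simp
        · congr 1
          refine chainCoeff_congr T fun w hw => ?_
          rw [dif_pos (by omega)]
      · rw [derivOp_eq, derivOp_eq]
        have : iteratedFDeriv 𝕜 1 (fderiv 𝕜 G) 0 (fun _ => ζ (n + 2)) =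
            ((n + 2)! : 𝕜)⁻¹ • iteratedFDeriv 𝕜 1 (fderiv 𝕜 G) 0 (fun _ => z (n + 2)) := by
          rw [iteratedFDeriv_one_apply, iteratedFDeriv_one_apply, hζ, map_smul]
        rw [this, smul_smul]
        congr 1
        rw [hc]
        ring
    have hterm : ∀ v ∈ Finset.Icc 1 (n + 2),
        (compCoeff 𝕜 (fderiv 𝕜 G) ζ (n + 1) v) ∘L (chainCoeff Sb T v (n + 2)) =
        (taylorCoeff (linFamily G z₀) v) ∘L (chainCoeff Sb T v (n + 2)) -
          if v = n + 2 then derivOp 𝕜 G 1 (fun _ => ζ (n + 2)) else 0 := by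
      intro v hv
      rw [Finset.mem_Icc] at hv
      rw [hcoef v hv.2, ContinuousLinearMap.sub_comp]
      split_ifs with h
      · rw [h, chainCoeff_self, ContinuousLinearMap.comp_id, ContinuousLinearMap.comp_id]
      · rw [ContinuousLinearMap.zero_comp]
    have hrange : Finset.range (n + 2 + 1) = insert 0 (Finset.Icc 1 (n + 2)) := by
      ext v
      simp only [Finset.mem_range, Finset.mem_insert, Finset.mem_Icc]
      omega
    rw [hstep, ← Finset.smul_sum, ← smul_add, smul_smul, hc0, one_smul, hrange,
      Finset.sum_insert (by simp), chainCoeff_zero_of_pos _ _ (by omega),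
      ContinuousLinearMap.comp_zero, zero_add, Finset.sum_congr rfl hterm,
      Finset.sum_sub_distrib, Finset.sum_ite_eq',
      if_pos (Finset.mem_Icc.2 ⟨by omega, le_rfl⟩), sub_add_cancel]

end LeadingOperators

/-! ### Projections of a fine resolution and the leading operator. -/

namespace FineResolution

variable {𝕜 E F : Type*} [RCLike 𝕜] [NormedAddCommGroup E] [NormedSpace 𝕜 E]
  [NormedAddCommGroup F] [NormedSpace 𝕜 F] {G : E → F} {z₀ : 𝕜 → E} {k l : ℕ}
  (D : FineResolution G z₀ k l)

/-- `S_{i+1}` as an operator on `E`. -/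
noncomputable abbrev Sop (i : ℕ) : E →L[𝕜] F := D.toResolutionData.S G z₀ i

/-- The kernels `N_i`. -/
noncomputable abbrev Nk (i : ℕ) : Submodule 𝕜 E := D.toResolutionData.N G z₀ i

/-- The ranges `R_i`. -/
noncomputable abbrev Rg (i : ℕ) : Submodule 𝕜 F := D.toResolutionData.R G z₀ i

/-- The operators `S̄_i`. -/
noncomputable abbrev sb (i : ℕ) : E →L[𝕜] F := D.toResolutionData.sbar G z₀ i

theorem mem_Nk_succ {i : ℕ} {x : E} : x ∈ D.Nk (i + 1) ↔ x ∈ D.Nk i ∧ D.Sop i x = 0 := by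
  simp [Nk, Sop, ResolutionData.N]

theorem Nk_antitone : Antitone D.Nk :=
  antitone_nat_of_succ_le fun _ _ hx => (D.mem_Nk_succ.1 hx).1

theorem Sop_eq_zero {i j : ℕ} (h : i < j) {x : E} (hx : x ∈ D.Nk j) : D.Sop i x = 0 :=
  (D.mem_Nk_succ.1 (D.Nk_antitone h hx)).2

theorem Sop_mem {i : ℕ} {x : E} (hx : x ∈ D.Nk i) : D.Sop i x ∈ D.Rg (i + 1) :=
  Submodule.mem_map_of_mem hx

theorem Nc_le {i : ℕ} (hi : i ≤ k) : D.Nc (i + 1) ≤ D.Nk i :=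
  le_sup_left.trans (D.N_sup i hi).le

theorem Rg_le {i : ℕ} (hi : i ≤ k) : D.Rg (i + 1) ≤ D.Rc i :=
  le_sup_left.trans (D.R_sup i hi).le

theorem Rc_succ_le {i : ℕ} (hi : i ≤ k) : D.Rc (i + 1) ≤ D.Rc i :=
  le_sup_right.trans (D.R_sup i hi).le

theorem Rc_le {i j : ℕ} (hij : i ≤ j) (hj : j ≤ k + 1) : D.Rc j ≤ D.Rc i := by
  induction j, hij using Nat.le_induction with
  | base => exact le_rfl
  | succ j _ ih => exact (D.Rc_succ_le (by omega)).trans (ih (by omega))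

theorem PRc_of_mem {i : ℕ} (hi : i ≤ k + 1) {y : F} (hy : y ∈ D.Rc i) : D.PRc i y = y := by
  cases i with
  | zero => rw [D.PRc_zero]; rfl
  | succ i => exact D.PRc_of_mem_Rc i (by omega) y hy

theorem PRc_of_mem_Rg {i j : ℕ} (hi : i ≤ k + 1) (hj : j < i) {y : F} (hy : y ∈ D.Rg (j + 1)) :
    D.PRc i y = 0 := by
  cases i with
  | zero => omega
  | succ i => exact D.PRc_of_mem_R i (by omega) j (by omega) y hy

theorem PRc_of_mem_Rg_of_le {i j : ℕ} (hij : i ≤ j) (hj : j ≤ k) {y : F}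
    (hy : y ∈ D.Rg (j + 1)) : D.PRc i y = y :=
  D.PRc_of_mem (by omega) (D.Rc_le hij (by omega) (D.Rg_le hj hy))

/-- The projections `P_{R_i^c}` have range in `R_i^c`. -/
theorem PRc_mem {i : ℕ} (hi : i ≤ k + 1) (y : F) : D.PRc i y ∈ D.Rc i := by
  -- The structure prescribes `P_{R_i^c}` on the summands only. Stripping the components in `R_1, …,
  -- R_i` from `y` leaves `c ∈ R_i^c`; the claim covers all later projections as well, which the
  -- induction requires.
  have key : ∀ i ≤ k + 1, ∀ y : F, ∃ c ∈ D.Rc i, ∀ j, i ≤ j → j ≤ k + 1 → D.PRc j (y - c) = 0 := by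
    intro i
    induction i with
    | zero =>
      intro _ y
      exact ⟨y, by rw [D.Rc_zero]; trivial, fun j _ _ => by simp⟩
    | succ i ih =>
      intro hi y
      obtain ⟨c, hc, h⟩ := ih (by omega) y
      rw [← D.R_sup i (by omega)] at hc
      obtain ⟨r, hr, d, hd, rfl⟩ := Submodule.mem_sup.1 hc
      refine ⟨d, hd, fun j hj hjk => ?_⟩
      have h1 := h j (by omega) hjk
      have h2 := D.PRc_of_mem_Rg hjk (by omega : i < j) hr
      rw [show y - d = y - (r + d) + r by abel, map_add, h1, h2, add_zero]
  obtain ⟨c, hc, h⟩ := key i hi y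
  have := h i le_rfl hi
  rw [map_sub, D.PRc_of_mem hi hc, sub_eq_zero] at this
  rwa [this]

/-- Injectivity of `S_{i+1}` on `N_{i+1}^c`, from `N_{i+1}^c ∩ ker S_{i+1} = 0`. -/
theorem Nc_ext {i : ℕ} (hi : i ≤ k) {x x' : E} (hx : x ∈ D.Nc (i + 1)) (hx' : x' ∈ D.Nc (i + 1))
    (h : D.Sop i x = D.Sop i x') : x = x' := by
  rw [← sub_eq_zero, ← Submodule.mem_bot 𝕜, ← D.N_inf i hi]
  have hm := (D.Nc (i + 1)).sub_mem hx hx'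
  exact ⟨hm, D.mem_Nk_succ.2 ⟨D.Nc_le hi hm, by rw [map_sub, h, sub_self]⟩⟩

theorem SinvP_of_mem_Rg {i j : ℕ} (hi : i ≤ k) (hj : j ≤ k) (hij : i ≠ j) {y : F}
    (hy : y ∈ D.Rg (j + 1)) : D.SinvP (i + 1) y = 0 := by
  refine D.Nc_ext hi (D.SinvP_mem i hi y) (Submodule.zero_mem _) ?_
  rw [map_zero]
  refine (D.S_SinvP i hi y).trans ?_
  rcases lt_or_gt_of_ne hij with h | h
  · rw [D.PRc_of_mem_Rg_of_le h.le hj hy, D.PRc_of_mem_Rg_of_le h hj hy, sub_self]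
  · rw [D.PRc_of_mem_Rg (by omega) h hy, D.PRc_of_mem_Rg (by omega) (by omega : j < i + 1) hy,
      sub_self]

theorem Sop_SinvP_Sop {i : ℕ} (hi : i ≤ k) {x : E} (hx : x ∈ D.Nk i) :
    D.Sop i (D.SinvP (i + 1) (D.Sop i x)) = D.Sop i x := by
  refine (D.S_SinvP i hi _).trans ?_
  rw [D.PRc_of_mem_Rg_of_le le_rfl hi (D.Sop_mem hx),
    D.PRc_of_mem_Rg (by omega) (Nat.lt_succ_self i) (D.Sop_mem hx), sub_zero]

theorem SinvP_Sop {i : ℕ} (hi : i ≤ k) {x : E} (hx : x ∈ D.Nc (i + 1)) :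
    D.SinvP (i + 1) (D.Sop i x) = x :=
  D.Nc_ext hi (D.SinvP_mem i hi _) hx (D.Sop_SinvP_Sop hi (D.Nc_le hi hx))

theorem SinvP_mem_Nk {i : ℕ} (hi : i ≤ k) (y : F) : D.SinvP (i + 1) y ∈ D.Nk i :=
  D.Nc_le hi (D.SinvP_mem i hi y)

/-- The projection of `E` onto `N_i` along `N_1^c ⊕ ⋯ ⊕ N_i^c`. -/
noncomputable def kerProj : ℕ → E →L[𝕜] E
  | 0 => ContinuousLinearMap.id 𝕜 E
  | i + 1 => kerProj i - (D.SinvP (i + 1)) ∘L (D.Sop i) ∘L kerProj i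

/-- The projection of `E` onto `N_{i+1}^c`. -/
noncomputable def compProj (i : ℕ) : E →L[𝕜] E :=
  (D.SinvP (i + 1)) ∘L (D.Sop i) ∘L D.kerProj i

theorem kerProj_succ (i : ℕ) : D.kerProj (i + 1) = D.kerProj i - D.compProj i := rfl

theorem kerProj_mem {i : ℕ} (hi : i ≤ k + 1) (x : E) : D.kerProj i x ∈ D.Nk i := by
  induction i with
  | zero => exact Submodule.mem_top
  | succ i ih =>
    have h := ih (by omega)
    refine D.mem_Nk_succ.2 ⟨Submodule.sub_mem _ h (D.SinvP_mem_Nk (by omega) _), ?_⟩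
    rw [kerProj_succ, sub_apply, map_sub, sub_eq_zero]
    exact (D.Sop_SinvP_Sop (by omega) h).symm

theorem compProj_mem {i : ℕ} (hi : i ≤ k) (x : E) : D.compProj i x ∈ D.Nc (i + 1) :=
  D.SinvP_mem i hi _

theorem kerProj_of_mem {i : ℕ} {x : E} (hx : x ∈ D.Nk i) : D.kerProj i x = x := by
  induction i with
  | zero => rfl
  | succ i ih =>
    obtain ⟨h1, h2⟩ := D.mem_Nk_succ.1 hx
    rw [kerProj_succ, sub_apply, ih h1, compProj,
      ContinuousLinearMap.comp_apply, ContinuousLinearMap.comp_apply, ih h1, h2, map_zero, sub_zero]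

theorem kerProj_of_mem_Nc {i j : ℕ} (hj : j ≤ k) (hji : j < i) {x : E} (hx : x ∈ D.Nc (j + 1)) :
    D.kerProj i x = 0 := by
  induction i, hji using Nat.le_induction with
  | base =>
    rw [kerProj_succ, sub_apply, compProj, ContinuousLinearMap.comp_apply,
      ContinuousLinearMap.comp_apply, D.kerProj_of_mem (D.Nc_le hj hx), D.SinvP_Sop hj hx, sub_self]
  | succ i _ ih =>
    rw [kerProj_succ, sub_apply, compProj, ContinuousLinearMap.comp_apply,
      ContinuousLinearMap.comp_apply, ih, map_zero, map_zero, sub_zero]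

theorem Sop_kerProj_of_mem_Nc {i j : ℕ} (hj : j ≤ k) {x : E} (hx : x ∈ D.Nc (j + 1)) :
    D.Sop i (D.kerProj i x) = if i = j then D.Sop j x else 0 := by
  rcases lt_trichotomy i j with h | rfl | h
  · rw [if_neg h.ne, D.kerProj_of_mem (D.Nk_antitone h.le (D.Nc_le hj hx)),
      D.Sop_eq_zero h (D.Nc_le hj hx)]
  · rw [if_pos rfl, D.kerProj_of_mem (D.Nc_le hj hx)]
  · rw [if_neg h.ne', D.kerProj_of_mem_Nc hj h hx, map_zero]

theorem compProj_of_mem_Nc {i j : ℕ} (hj : j ≤ k) {x : E} (hx : x ∈ D.Nc (j + 1)) :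
    D.compProj i x = if i = j then x else 0 := by
  rw [compProj, ContinuousLinearMap.comp_apply, ContinuousLinearMap.comp_apply,
    D.Sop_kerProj_of_mem_Nc hj hx]
  split_ifs with h
  · rw [h, D.SinvP_Sop hj hx]
  · rw [map_zero]

theorem compProj_of_mem_Nk {i j : ℕ} (hij : i < j) {x : E} (hx : x ∈ D.Nk j) :
    D.compProj i x = 0 := by
  rw [compProj, ContinuousLinearMap.comp_apply, ContinuousLinearMap.comp_apply,
    D.kerProj_of_mem (D.Nk_antitone hij.le hx), D.Sop_eq_zero hij hx, map_zero]

theorem sum_compProj (i : ℕ) :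
    ∑ j ∈ Finset.range i, D.compProj j + D.kerProj i = ContinuousLinearMap.id 𝕜 E := by
  induction i with
  | zero => simp [kerProj]
  | succ i ih => rw [Finset.sum_range_succ, kerProj_succ, ← ih]; abel

/-- The leading operator `∑ a_i S_{i+1}` of the blown-up family. -/
noncomputable def leadOp : E →L[𝕜] F :=
  ∑ i ∈ Finset.range (k + 1), wt 𝕜 i • (D.Sop i) ∘L D.kerProj i

/-- The inverse of `leadOp` modulo `N_{k+1}` and `R_{k+1}^c`. -/
noncomputable def leadInv : F →L[𝕜] E :=
  ∑ i ∈ Finset.range (k + 1), (wt 𝕜 i)⁻¹ • D.SinvP (i + 1)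

theorem leadOp_of_mem_Nc {j : ℕ} (hj : j ≤ k) {x : E} (hx : x ∈ D.Nc (j + 1)) :
    D.leadOp x = wt 𝕜 j • D.Sop j x := by
  rw [leadOp, sum_apply,
    Finset.sum_eq_single_of_mem j (Finset.mem_range.2 (by omega))]
  · rw [smul_apply, ContinuousLinearMap.comp_apply,
      D.Sop_kerProj_of_mem_Nc hj hx, if_pos rfl]
  · intro i _ hij
    rw [smul_apply, ContinuousLinearMap.comp_apply,
      D.Sop_kerProj_of_mem_Nc hj hx, if_neg hij, smul_zero]

theorem leadInv_of_mem_Rg {j : ℕ} (hj : j ≤ k) {y : F} (hy : y ∈ D.Rg (j + 1)) :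
    D.leadInv y = (wt 𝕜 j)⁻¹ • D.SinvP (j + 1) y := by
  rw [leadInv, sum_apply,
    Finset.sum_eq_single_of_mem j (Finset.mem_range.2 (by omega))]
  · rfl
  · intro i hi hij
    rw [smul_apply,
      D.SinvP_of_mem_Rg (by have := Finset.mem_range.1 hi; omega) hj hij hy, smul_zero]

theorem leadInv_comp_leadOp :
    D.leadInv ∘L D.leadOp = ContinuousLinearMap.id 𝕜 E - D.kerProj (k + 1) := by
  ext x
  rw [← D.sum_compProj (k + 1), add_sub_cancel_right, ContinuousLinearMap.comp_apply, leadOp,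
    sum_apply, sum_apply, map_sum]
  refine Finset.sum_congr rfl fun i hi => ?_
  have hi' : i ≤ k := by have := Finset.mem_range.1 hi; omega
  rw [smul_apply, ContinuousLinearMap.comp_apply, map_smul,
    D.leadInv_of_mem_Rg hi' (D.Sop_mem (D.kerProj_mem (by omega) x)), smul_smul,
    mul_inv_cancel₀ (wt_ne_zero i), one_smul]
  rfl

theorem leadOp_comp_leadInv :
    D.leadOp ∘L D.leadInv = ContinuousLinearMap.id 𝕜 F - D.PRc (k + 1) := by
  ext y
  have : ∀ i ∈ Finset.range (k + 1), D.leadOp (((wt 𝕜 i)⁻¹ • D.SinvP (i + 1)) y) =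
      D.PRc i y - D.PRc (i + 1) y := by
    intro i hi
    have hi' : i ≤ k := by have := Finset.mem_range.1 hi; omega
    rw [smul_apply, map_smul, D.leadOp_of_mem_Nc hi' (D.SinvP_mem i hi' y),
      smul_smul, inv_mul_cancel₀ (wt_ne_zero i), one_smul]
    exact D.S_SinvP i hi' y
  rw [ContinuousLinearMap.comp_apply, leadInv, sum_apply, map_sum,
    Finset.sum_congr rfl this, Finset.sum_range_sub' (fun i => D.PRc i y), D.PRc_zero]
  rfl

theorem PRc_comp_leadOp : D.PRc (k + 1) ∘L D.leadOp = 0 := by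
  ext x
  rw [ContinuousLinearMap.comp_apply, leadOp, sum_apply, map_sum]
  refine Finset.sum_eq_zero fun i hi => ?_
  have hi' : i ≤ k := by have := Finset.mem_range.1 hi; omega
  rw [smul_apply, map_smul, ContinuousLinearMap.comp_apply,
    D.PRc_of_mem_Rg le_rfl (by omega) (D.Sop_mem (D.kerProj_mem (by omega) x)), smul_zero]

theorem PRc_eq_zero_iff : D.PRc (k + 1) = 0 ↔ D.Rc (k + 1) = ⊥ := by
  constructor
  · intro h
    rw [eq_bot_iff]
    intro y hy
    rw [Submodule.mem_bot, ← D.PRc_of_mem le_rfl hy, h]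
    rfl
  · intro h
    ext y
    have := D.PRc_mem le_rfl y
    rw [h] at this
    exact (Submodule.mem_bot 𝕜).1 this

/-- The relation `∑_{i ≤ m} S̄_i E_{i,m} = P_{R_{m-1}^c} S̄_m`. -/
theorem sum_sbar_comp_Eop {m : ℕ} (hm : m ≤ k) :
    ∑ i ∈ Finset.range (m + 1), (D.sb (i + 1)) ∘L (Eop D.sb D.SinvP (i + 1) (m + 1)) =
      D.Sop m := by
  set r : ℕ → E →L[𝕜] F := fun i =>
    ∑ v ∈ Finset.Ico i (m + 2), (D.sb v) ∘L (Eop D.sb D.SinvP v (m + 1)) with hr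
  -- The definition of `E` gives `r (i + 1) = r (i + 2) - S̄_{i+1} S_{i+1}⁻¹ P_{R_{i+1}} r (i + 2)`.
  -- Applying `P_{R_i^c}` removes precisely the `R_{i+1}`-component of the tail sum. Iteration
  -- leaves only its last summand, `S̄_{m+1}`.
  have hstep : ∀ i, i < m → D.PRc i ∘L r (i + 1) = D.PRc (i + 1) ∘L r (i + 2) := by
    intro i hi
    have h1 : r (i + 1) = (D.sb (i + 1)) ∘L (Eop D.sb D.SinvP (i + 1) (m + 1)) + r (i + 2) :=
      Finset.sum_eq_sum_Ico_succ_bot (by omega) _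
    have h2 : Eop D.sb D.SinvP (i + 1) (m + 1) = -((D.SinvP (i + 1)) ∘L r (i + 2)) :=
      Eop_of_lt _ _ (by omega)
    ext x
    have h3 := D.S_SinvP i (by omega) (r (i + 2) x)
    rw [ResolutionData.S, ContinuousLinearMap.comp_apply] at h3
    rw [h1, h2]
    simp only [ContinuousLinearMap.comp_apply, add_apply,
      neg_apply, map_add, map_neg]
    rw [h3]
    abel
  have hall : ∀ i ≤ m, D.PRc 0 ∘L r 1 = D.PRc i ∘L r (i + 1) := by
    intro i
    induction i with
    | zero => intro _; rfl
    | succ i ih => intro hi; rw [ih (by omega), hstep i (by omega)]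
  have h1 : D.PRc 0 ∘L r 1 =
      ∑ i ∈ Finset.range (m + 1), (D.sb (i + 1)) ∘L (Eop D.sb D.SinvP (i + 1) (m + 1)) := by
    rw [D.PRc_zero, ContinuousLinearMap.id_comp, hr]
    simp only
    rw [Finset.sum_Ico_eq_sum_range]
    simp only [add_comm 1]
    rfl
  rw [← h1, hall m le_rfl]
  have h2 : r (m + 1) = D.sb (m + 1) := by
    simp only [hr]
    rw [Finset.sum_Ico_succ_top (by omega), Finset.Ico_self, Finset.sum_empty, zero_add, Eop_self,
      ContinuousLinearMap.comp_id]
  rw [h2]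
  rfl

/-- Off the diagonal the entries of `E` take values in `N_{i+1}^c ⊆ N_i`; thus the chain of order
`i` may be applied to them. -/
theorem Eop_mem_Nk {i m : ℕ} (him : i ≤ m) (hm : m ≤ k) {x : E} (hx : x ∈ D.Nk m) :
    Eop D.sb D.SinvP (i + 1) (m + 1) x ∈ D.Nk i := by
  rcases him.lt_or_eq with h | rfl
  · rw [Eop_of_lt _ _ (by omega)]
    exact Submodule.neg_mem _ (D.SinvP_mem_Nk (by omega) _)
  · rw [Eop_self]
    exact hx

end FineResolution

/-! ### Expansions with a continuous remainder. -/

section ContinuousNear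

variable {𝕜 X E F H : Type*} [RCLike 𝕜] [NormedAddCommGroup X] [NormedSpace 𝕜 X]
  [NormedAddCommGroup E] [NormedSpace 𝕜 E] [NormedAddCommGroup F] [NormedSpace 𝕜 F]
  [NormedAddCommGroup H]

/-- Continuity on a neighbourhood of the origin. -/
def ContinuousNear {𝕜 H : Type*} [RCLike 𝕜] [NormedAddCommGroup H] (f : 𝕜 → H) : Prop := ∀ᶠ ε in 𝓝 (0 : 𝕜), ContinuousAt f ε

namespace ContinuousNear

theorem of_continuous {f : 𝕜 → H} (hf : Continuous f) : ContinuousNear f :=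
  Eventually.of_forall fun _ => hf.continuousAt

theorem continuousAt {f : 𝕜 → H} (hf : ContinuousNear f) : ContinuousAt f 0 :=
  Eventually.self_of_nhds hf

theorem isBigO_one {f : 𝕜 → H} (hf : ContinuousNear f) : f =O[𝓝 0] fun _ => (1 : ℝ) :=
  hf.continuousAt.isBigO_one ℝ

theorem add {f g : 𝕜 → H} (hf : ContinuousNear f) (hg : ContinuousNear g) :
    ContinuousNear fun ε => f ε + g ε := by
  filter_upwards [hf, hg] with ε h1 h2 using h1.add h2

theorem sub {f g : 𝕜 → H} (hf : ContinuousNear f) (hg : ContinuousNear g) :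
    ContinuousNear fun ε => f ε - g ε := by
  filter_upwards [hf, hg] with ε h1 h2 using h1.sub h2

theorem const (c : H) : ContinuousNear fun _ : 𝕜 => c := of_continuous continuous_const

theorem sum {ι : Type*} {s : Finset ι} {f : ι → 𝕜 → H} (h : ∀ i ∈ s, ContinuousNear (f i)) :
    ContinuousNear fun ε => ∑ i ∈ s, f i ε := by
  have : ∀ᶠ ε in 𝓝 (0 : 𝕜), ∀ i ∈ s, ContinuousAt (f i) ε := (eventually_all_finset s).2 h
  filter_upwards [this] with ε h1 using tendsto_finsetSum s h1

theorem clm_comp {f : 𝕜 → F →L[𝕜] X} {g : 𝕜 → E →L[𝕜] F} (hf : ContinuousNear f)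
    (hg : ContinuousNear g) : ContinuousNear fun ε => (f ε) ∘L (g ε) := by
  filter_upwards [hf, hg] with ε h1 h2 using h1.clm_comp h2

theorem clm_comp_const {f : 𝕜 → F →L[𝕜] X} (hf : ContinuousNear f) (A : E →L[𝕜] F) :
    ContinuousNear fun ε => (f ε) ∘L A := hf.clm_comp (const A)

theorem const_clm_comp {f : 𝕜 → E →L[𝕜] F} (A : F →L[𝕜] X) (hf : ContinuousNear f) :
    ContinuousNear fun ε => A ∘L (f ε) := (const A).clm_comp hf

variable [NormedSpace 𝕜 H]

theorem smul {c : 𝕜 → 𝕜} {f : 𝕜 → H} (hc : Continuous c) (hf : ContinuousNear f) :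
    ContinuousNear fun ε => c ε • f ε := by
  filter_upwards [hf] with ε h1 using hc.continuousAt.smul h1

theorem self_smul {f : 𝕜 → H} (hf : ContinuousNear f) : ContinuousNear fun ε => ε • f ε :=
  smul (c := fun ε => ε) continuous_id hf

theorem const_smul (c : 𝕜) {f : 𝕜 → H} (hf : ContinuousNear f) : ContinuousNear fun ε => c • f ε :=
  smul (c := fun _ => c) continuous_const hf

end ContinuousNear

variable [NormedSpace 𝕜 H]

/-- `f` is a polynomial of degree less than `n` with coefficients `c`, up to `ε^n` times a
continuous remainder. -/
def HasExpansion (f : 𝕜 → H) (n : ℕ) (c : ℕ → H) : Prop :=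
  ∃ R : 𝕜 → H, ContinuousNear R ∧
    ∀ ε : 𝕜, f ε = ∑ v ∈ Finset.range n, ε ^ v • c v + ε ^ n • R ε

theorem HasExpansion.of_le {f : 𝕜 → H} {n m : ℕ} {c : ℕ → H} (h : HasExpansion f n c)
    (hmn : m ≤ n) : HasExpansion f m c := by
  induction n, hmn using Nat.le_induction with
  | base => exact h
  | succ n _ ih =>
    obtain ⟨R, hR, hf⟩ := h
    refine ih ⟨fun ε => c n + ε • R ε,
      (ContinuousNear.const _).add hR.self_smul, fun ε => ?_⟩
    rw [hf, Finset.sum_range_succ, smul_add, smul_smul, pow_succ]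
    abel

theorem HasExpansion.continuousNear {f : 𝕜 → H} {n : ℕ} {c : ℕ → H} (h : HasExpansion f n c) :
    ContinuousNear f := by
  obtain ⟨R, hR, hf⟩ := h
  have : f = fun ε => ∑ v ∈ Finset.range n, ε ^ v • c v + ε ^ n • R ε := funext hf
  rw [this]
  exact (ContinuousNear.of_continuous (by fun_prop)).add (ContinuousNear.smul (by fun_prop) hR)

/-- The truncated Cauchy product: monomials of degree at least `n` are moved into the remainder. -/
theorem HasExpansion.comp_polynomial {L : 𝕜 → E →L[𝕜] F} {n : ℕ} {c : ℕ → E →L[𝕜] F}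
    (h : HasExpansion L n c) (y : ℕ → X →L[𝕜] E) :
    HasExpansion (fun ε => (L ε) ∘L ∑ d ∈ Finset.range n, ε ^ d • y d) n
      fun m => ∑ v ∈ Finset.range (m + 1), (c v) ∘L (y (m - v)) := by
  obtain ⟨R, hR, hL⟩ := h
  refine ⟨fun ε => (R ε) ∘L (∑ d ∈ Finset.range n, ε ^ d • y d) +
    ∑ v ∈ Finset.range n, ∑ e ∈ Finset.range v, ε ^ e • (c v) ∘L (y (n - v + e)), ?_, fun ε => ?_⟩
  · refine (hR.clm_comp (.of_continuous (by fun_prop))).add (.of_continuous (by fun_prop))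
  · have hv : ∀ v ∈ Finset.range n, (ε ^ v • c v) ∘L (∑ d ∈ Finset.range n, ε ^ d • y d) =
        ∑ d ∈ Finset.range (n - v), ε ^ (v + d) • (c v) ∘L (y d) +
          ε ^ n • ∑ e ∈ Finset.range v, ε ^ e • (c v) ∘L (y (n - v + e)) := by
      intro v hv
      have hvn := Finset.mem_range.1 hv
      have e1 : ∑ d ∈ Finset.range n, ε ^ d • y d = ∑ d ∈ Finset.range (n - v), ε ^ d • y d +
          ∑ e ∈ Finset.range v, ε ^ (n - v + e) • y (n - v + e) := by
        rw [← Finset.sum_range_add (fun d => ε ^ d • y d), Nat.sub_add_cancel hvn.le]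
      rw [e1, ContinuousLinearMap.comp_add, ContinuousLinearMap.comp_finsetSum,
        ContinuousLinearMap.comp_finsetSum, Finset.smul_sum]
      congr 1
      · refine Finset.sum_congr rfl fun d _ => ?_
        rw [ContinuousLinearMap.smul_comp, ContinuousLinearMap.comp_smul, smul_smul, pow_add]
      · refine Finset.sum_congr rfl fun d _ => ?_
        rw [ContinuousLinearMap.smul_comp, ContinuousLinearMap.comp_smul, smul_smul, smul_smul,
          ← pow_add, ← pow_add]
        congr 2
        omega
    beta_reduce
    rw [hL, ContinuousLinearMap.add_comp, ContinuousLinearMap.finsetSum_comp,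
      Finset.sum_congr rfl hv, Finset.sum_add_distrib, ← Finset.smul_sum, add_assoc,
      ContinuousLinearMap.smul_comp, smul_add, add_comm (ε ^ n • _ ∘L _)]
    congr 1
    have e2 := Finset.sum_range_diag_flip n (fun v d => ε ^ (v + d) • (c v) ∘L (y d))
    rw [← e2]
    refine Finset.sum_congr rfl fun m _ => ?_
    rw [Finset.smul_sum]
    refine Finset.sum_congr rfl fun v hv => ?_
    have := Finset.mem_range.1 hv
    rw [show v + (m - v) = m by omega]

end ContinuousNear

/-! ### Chain polynomials and the orders at which `L(ε)` maps them. -/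

section ChainPolynomial

variable {𝕜 E F : Type*} [RCLike 𝕜] [NormedAddCommGroup E] [NormedSpace 𝕜 E]
  [NormedAddCommGroup F] [NormedSpace 𝕜 F]

/-- The chain polynomial of order `j`. -/
noncomputable def chainPoly (Sb : ℕ → E →L[𝕜] F) (T : ℕ → F →L[𝕜] E) (j : ℕ) (ε : 𝕜) :
    E →L[𝕜] E :=
  ∑ d ∈ Finset.range (j + 1), ε ^ d • chainCoeff Sb T (j - d) j

variable (Sb : ℕ → E →L[𝕜] F) (T : ℕ → F →L[𝕜] E)

theorem continuous_chainPoly (j : ℕ) : Continuous (chainPoly Sb T j) := by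
  unfold chainPoly
  fun_prop

theorem chainPoly_eq (j : ℕ) (ε : 𝕜) :
    chainPoly Sb T j ε = ∑ u ∈ Finset.range (j + 1), ε ^ (j - u) • chainCoeff Sb T u j := by
  rw [chainPoly, ← Finset.sum_range_reflect]
  refine Finset.sum_congr rfl fun u hu => ?_
  have := Finset.mem_range.1 hu
  rw [show j + 1 - 1 - u = j - u by omega, show j - (j - u) = u by omega]

/-- The factor `ε^{j-m}` lifts the chain of order `m`, which `L` maps to order `m`, to the common
order `j`; hence all summands contribute to the leading coefficient. -/
theorem chainPoly_succ (j : ℕ) (ε : 𝕜) :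
    chainPoly Sb T (j + 1) ε = ∑ m ∈ Finset.range (j + 1),
      (wt 𝕜 j / wt 𝕜 m) • ε ^ (j - m) • (chainPoly Sb T m ε) ∘L (Eop Sb T (m + 1) (j + 1)) := by
  rw [chainPoly_eq, Finset.sum_range_succ', chainCoeff_zero_of_pos _ _ (by omega), smul_zero,
    add_zero]
  have h : ∀ m ∈ Finset.range (j + 1),
      (wt 𝕜 j / wt 𝕜 m) • ε ^ (j - m) • (chainPoly Sb T m ε) ∘L (Eop Sb T (m + 1) (j + 1)) =
      ∑ u ∈ Finset.range (j + 1), ε ^ (j - u) • (wt 𝕜 j / wt 𝕜 m) •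
        (chainCoeff Sb T u m) ∘L (Eop Sb T (m + 1) (j + 1)) := by
    intro m hm
    have hmj := Finset.mem_range.1 hm
    rw [chainPoly_eq, ContinuousLinearMap.finsetSum_comp, Finset.smul_sum, Finset.smul_sum]
    have hsub : Finset.range (m + 1) ⊆ Finset.range (j + 1) := Finset.range_mono (by omega)
    rw [← Finset.sum_subset hsub]
    · refine Finset.sum_congr rfl fun u hu => ?_
      have := Finset.mem_range.1 hu
      rw [ContinuousLinearMap.smul_comp, smul_smul (ε ^ (j - m)), ← pow_add,
        show j - m + (m - u) = j - u by omega, smul_comm]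
    · intro u _ hu
      rw [chainCoeff_of_gt _ _ (by rw [Finset.mem_range] at hu; omega),
        ContinuousLinearMap.zero_comp, smul_zero, smul_zero]
  rw [Finset.sum_congr rfl h, Finset.sum_comm]
  refine Finset.sum_congr rfl fun u _ => ?_
  rw [chainCoeff_succ, Finset.smul_sum, Nat.add_sub_cancel, Nat.add_sub_add_right]

theorem exists_chainPoly_eq (j : ℕ) : ∃ Q : 𝕜 → E →L[𝕜] E, Continuous Q ∧
    ∀ ε, chainPoly Sb T j ε = ContinuousLinearMap.id 𝕜 E + ε • Q ε := by
  refine ⟨fun ε => ∑ d ∈ Finset.range j, ε ^ d • chainCoeff Sb T (j - (d + 1)) j, by fun_prop,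
    fun ε => ?_⟩
  rw [chainPoly, Finset.sum_range_succ', Nat.sub_zero, chainCoeff_self, pow_zero, one_smul,
    add_comm, Finset.smul_sum]
  simp only [smul_smul, pow_succ']

end ChainPolynomial

namespace FineResolution

variable {𝕜 E F : Type*} [RCLike 𝕜] [NormedAddCommGroup E] [NormedSpace 𝕜 E]
  [NormedAddCommGroup F] [NormedSpace 𝕜 F] {G : E → F} {z₀ : 𝕜 → E} {k l : ℕ}
  (D : FineResolution G z₀ k l)

/-- The chain polynomials of the resolution. -/
noncomputable abbrev chain (j : ℕ) (ε : 𝕜) : E →L[𝕜] E := chainPoly D.sb D.SinvP j ε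

/-- The family `L` has an expansion up to order `k` whose coefficients are compatible with the
operators `S̄_1, …, S̄_{k+1}` of the resolution. -/
structure IsAdapted (L : 𝕜 → E →L[𝕜] F) (c : ℕ → E →L[𝕜] F) : Prop where
  expansion : HasExpansion L (k + 1) c
  wt_smul_sb : ∀ j ≤ k, wt 𝕜 j • D.sb (j + 1) =
    ∑ v ∈ Finset.range (j + 1), (c v) ∘L (chainCoeff D.sb D.SinvP v j)

variable {D} {L : 𝕜 → E →L[𝕜] F} {c : ℕ → E →L[𝕜] F}

/-- Once the order `j` is known on `N_j`, all coefficients below `j` of the product expansion vanish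
there, by uniqueness of coefficients; the coefficient of `ε^j` is `wt j • S̄_{j+1}` by adaptedness.
-/
theorem IsAdapted.chain_of_le (h : D.IsAdapted L c) {j : ℕ} (hj : j ≤ k)
    (hlow : ∃ H : 𝕜 → E →L[𝕜] F, ContinuousNear H ∧
      ∀ ε, ∀ x ∈ D.Nk j, L ε (D.chain j ε x) = ε ^ j • H ε x) :
    ∃ H : 𝕜 → E →L[𝕜] F, ContinuousNear H ∧ ∀ ε, ∀ x ∈ D.Nk j,
      L ε (D.chain j ε x) = ε ^ j • (wt 𝕜 j • D.sb (j + 1) x + ε • H ε x) := by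
  obtain ⟨H, hH, hHx⟩ := hlow
  obtain ⟨K, hK, hKx⟩ := (h.expansion.of_le (Nat.succ_le_succ hj)).comp_polynomial
    fun d => chainCoeff D.sb D.SinvP (j - d) j
  set w : ℕ → E →L[𝕜] F := fun m =>
    ∑ v ∈ Finset.range (m + 1), (c v) ∘L (chainCoeff D.sb D.SinvP (j - (m - v)) j) with hw
  have hwj : w j = wt 𝕜 j • D.sb (j + 1) := by
    rw [h.wt_smul_sb j hj, hw]
    refine Finset.sum_congr rfl fun v hv => ?_
    have := Finset.mem_range.1 hv
    rw [show j - (j - v) = v by omega]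
  have hexp : ∀ ε x, L ε (D.chain j ε x) =
      ∑ m ∈ Finset.range j, ε ^ m • w m x + ε ^ j • (w j x + ε • K ε x) := by
    intro ε x
    have := congrArg (fun A : E →L[𝕜] F => A x) (hKx ε)
    simp only [Nat.succ_eq_add_one] at this
    refine this.trans ?_
    rw [add_apply, sum_apply, Finset.sum_range_succ, smul_add, smul_smul, ← pow_succ, add_assoc]
    rfl
  refine ⟨K, hK, fun ε x hx => ?_⟩
  have hzero : ∀ m < j, w m x = 0 := by
    refine coeff_eq_zero_of_isBigO (𝕜 := 𝕜) j (fun m => w m x) ?_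
    have e : ∀ ε : 𝕜, ∑ m ∈ Finset.range j, ε ^ m • w m x =
        ε ^ j • ((H ε - w j - ε • K ε) x) := by
      intro ε
      have h1 := hexp ε x
      rw [hHx ε x hx] at h1
      rw [← sub_eq_iff_eq_add] at h1
      rw [← h1, sub_apply, sub_apply, ← smul_sub, sub_sub]
      rfl
    simp only [e]
    have hA : ContinuousNear fun ε : 𝕜 => H ε - w j - ε • K ε :=
      (hH.sub (.const _)).sub hK.self_smul
    obtain ⟨B, hB⟩ := hA.isBigO_one.bound
    refine IsBigO.of_bound (B * ‖x‖) ?_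
    filter_upwards [hB.filter_mono nhdsWithin_le_nhds] with ε hε
    rw [norm_one, mul_one] at hε
    rw [norm_smul, norm_pow, norm_pow, norm_norm, mul_comm]
    gcongr
    exact (ContinuousLinearMap.le_opNorm _ _).trans (by gcongr)
  rw [hexp, Finset.sum_eq_zero, zero_add, hwj]
  · rfl
  · intro m hm
    rw [hzero m (Finset.mem_range.1 hm), smul_zero]

/-- The leading coefficients add up to `wt j • ∑ S̄_{m+1} E_{m+1,j+1}`, which is `wt j • S_{j+1}` by
`sum_sbar_comp_Eop`. -/
theorem chain_succ_of_chain {j : ℕ} (hj : j ≤ k)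
    (hlow : ∀ m ≤ j, ∃ H : 𝕜 → E →L[𝕜] F, ContinuousNear H ∧ ∀ ε, ∀ x ∈ D.Nk m,
      L ε (D.chain m ε x) = ε ^ m • (wt 𝕜 m • D.sb (m + 1) x + ε • H ε x)) :
    ∃ H : 𝕜 → E →L[𝕜] F, ContinuousNear H ∧ ∀ ε, ∀ x ∈ D.Nk j,
      L ε (D.chain (j + 1) ε x) = ε ^ j • (wt 𝕜 j • D.Sop j x + ε • H ε x) := by
  choose! H hH hHx using hlow
  refine ⟨fun ε => ∑ m ∈ Finset.range (j + 1),
    (wt 𝕜 j / wt 𝕜 m) • (H m ε) ∘L (Eop D.sb D.SinvP (m + 1) (j + 1)), ?_, fun ε x hx => ?_⟩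
  · refine ContinuousNear.sum fun m hm => ?_
    have hm' : m ≤ j := by have := Finset.mem_range.1 hm; omega
    exact ((hH m hm').clm_comp_const _).const_smul _
  · have hterm : ∀ m ∈ Finset.range (j + 1), L ε (((wt 𝕜 j / wt 𝕜 m) • ε ^ (j - m) •
        (D.chain m ε) ∘L (Eop D.sb D.SinvP (m + 1) (j + 1))) x) =
        ε ^ j • (wt 𝕜 j • ((D.sb (m + 1)) ∘L (Eop D.sb D.SinvP (m + 1) (j + 1))) x +
          ε • ((wt 𝕜 j / wt 𝕜 m) • (H m ε) ∘L (Eop D.sb D.SinvP (m + 1) (j + 1))) x) := by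
      intro m hm
      have hmj : m ≤ j := by have := Finset.mem_range.1 hm; omega
      have h1 := hHx m hmj ε _ (D.Eop_mem_Nk hmj hj hx)
      rw [smul_apply, smul_apply, map_smul, map_smul, ContinuousLinearMap.comp_apply, h1,
        ContinuousLinearMap.comp_apply, smul_apply, ContinuousLinearMap.comp_apply,
        smul_smul (ε ^ (j - m)), ← pow_add, Nat.sub_add_cancel hmj, smul_comm, smul_add,
        smul_smul (wt 𝕜 j / wt 𝕜 m) (wt 𝕜 m), div_mul_cancel₀ _ (wt_ne_zero m),
        smul_comm (wt 𝕜 j / wt 𝕜 m) ε]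
    rw [chain, chainPoly_succ, sum_apply, map_sum, Finset.sum_congr rfl hterm, ← Finset.smul_sum,
      Finset.sum_add_distrib, ← Finset.smul_sum, ← Finset.smul_sum, ← sum_apply, ← sum_apply,
      D.sum_sbar_comp_Eop hj]

theorem IsAdapted.exists_chain (h : D.IsAdapted L c) {j : ℕ} (hj : j ≤ k) :
    ∃ H : 𝕜 → E →L[𝕜] F, ContinuousNear H ∧ ∀ ε, ∀ x ∈ D.Nk j,
      L ε (D.chain j ε x) = ε ^ j • (wt 𝕜 j • D.sb (j + 1) x + ε • H ε x) := by
  induction j using Nat.strong_induction_on with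
  | _ j ih =>
    refine h.chain_of_le hj ?_
    cases j with
    | zero =>
      refine ⟨fun ε => (L ε) ∘L (D.chain 0 ε),
        h.expansion.continuousNear.clm_comp (.of_continuous (continuous_chainPoly _ _ _)),
        fun ε x _ => ?_⟩
      rw [pow_zero, one_smul]
      rfl
    | succ j =>
      obtain ⟨H, hH, hHx⟩ := chain_succ_of_chain (L := L) (by omega : j ≤ k)
        (fun m hm => ih m (by omega) (by omega))
      refine ⟨H, hH, fun ε x hx => ?_⟩
      -- On `N_{j+1}` the leading coefficient `S_{j+1} x` is zero, so the order rises from `j` to `j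
      -- + 1`.
      obtain ⟨h1, h2⟩ := D.mem_Nk_succ.1 hx
      rw [hHx ε x h1, h2, smul_zero, zero_add, smul_smul, ← pow_succ]

/-- The chain polynomials map `N_j` to approximate solutions of order `j`, with leading
coefficient given by `S_{j+1}`. -/
theorem IsAdapted.exists_chain_succ (h : D.IsAdapted L c) {j : ℕ} (hj : j ≤ k) :
    ∃ H : 𝕜 → E →L[𝕜] F, ContinuousNear H ∧ ∀ ε, ∀ x ∈ D.Nk j,
      L ε (D.chain (j + 1) ε x) = ε ^ j • (wt 𝕜 j • D.Sop j x + ε • H ε x) :=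
  chain_succ_of_chain hj fun _ hm => h.exists_chain (hm.trans hj)

end FineResolution

/-- A continuous operator family which is the identity at the origin is invertible near it. -/
theorem ContinuousNear.exists_inverse {𝕜 E : Type*} [RCLike 𝕜] [NormedAddCommGroup E]
    [NormedSpace 𝕜 E] [CompleteSpace E] {f : 𝕜 → E →L[𝕜] E} (hf : ContinuousNear f)
    (h0 : f 0 = ContinuousLinearMap.id 𝕜 E) :
    ∃ g : 𝕜 → E →L[𝕜] E, ContinuousNear g ∧ g 0 = ContinuousLinearMap.id 𝕜 E ∧
      ∀ᶠ ε in 𝓝 (0 : 𝕜), (∀ x, f ε (g ε x) = x) ∧ ∀ x, g ε (f ε x) = x := by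
  have hu0 : IsUnit (f 0) := by rw [h0]; exact isUnit_one
  have hu : ∀ᶠ ε in 𝓝 (0 : 𝕜), IsUnit (f ε) :=
    hf.continuousAt.eventually (Units.isOpen.mem_nhds hu0)
  refine ⟨fun ε => Ring.inverse (f ε), ?_, ?_, ?_⟩
  · filter_upwards [hf, hu] with ε h1 h2
    obtain ⟨u, hu⟩ := h2
    have := NormedRing.inverse_continuousAt u
    rw [hu] at this
    exact ContinuousAt.comp (g := Ring.inverse) this h1
  · simp only [h0]
    exact Ring.inverse_one _
  · filter_upwards [hu] with ε h
    refine ⟨fun x => ?_, fun x => ?_⟩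
    · exact congrArg (fun A : E →L[𝕜] E => A x) (Ring.mul_inverse_cancel _ h)
    · exact congrArg (fun A : E →L[𝕜] E => A x) (Ring.inverse_mul_cancel _ h)

/-! ### The blown-up family; a right inverse of order `k` forces `R_{k+1}^c = 0`. -/

namespace FineResolution

variable {𝕜 E F : Type*} [RCLike 𝕜] [NormedAddCommGroup E] [NormedSpace 𝕜 E]
  [NormedAddCommGroup F] [NormedSpace 𝕜 F] {G : E → F} {z₀ : 𝕜 → E} {k l : ℕ}
  (D : FineResolution G z₀ k l)

/-- The projection of `E` onto `N^c` along `N_{k+1}`. -/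
noncomputable def imProj : E →L[𝕜] E := ContinuousLinearMap.id 𝕜 E - D.kerProj (k + 1)

/-- The projection of `E` onto `N_{k+1}` along `N^c`. -/
noncomputable abbrev lastProj : E →L[𝕜] E := D.kerProj (k + 1)

theorem imProj_apply (x : E) : D.imProj x = x - D.lastProj x := rfl

theorem imProj_eq_sum (x : E) : D.imProj x = ∑ i ∈ Finset.range (k + 1), D.compProj i x := by
  rw [imProj, ← D.sum_compProj (k + 1), add_sub_cancel_right, sum_apply]

theorem compProj_compProj {i j : ℕ} (hj : j ≤ k) (x : E) :
    D.compProj i (D.compProj j x) = if i = j then D.compProj j x else 0 :=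
  D.compProj_of_mem_Nc hj (D.compProj_mem hj x)

theorem lastProj_compProj {j : ℕ} (hj : j ≤ k) (x : E) : D.lastProj (D.compProj j x) = 0 :=
  D.kerProj_of_mem_Nc hj (by omega) (D.compProj_mem hj x)

theorem compProj_lastProj {j : ℕ} (hj : j ≤ k) (x : E) : D.compProj j (D.lastProj x) = 0 :=
  D.compProj_of_mem_Nk (by omega : j < k + 1) (D.kerProj_mem le_rfl x)

theorem lastProj_lastProj (x : E) : D.lastProj (D.lastProj x) = D.lastProj x :=
  D.kerProj_of_mem (D.kerProj_mem le_rfl x)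

theorem imProj_lastProj (x : E) : D.imProj (D.lastProj x) = 0 := by
  rw [imProj_apply, lastProj_lastProj, sub_self]

theorem lastProj_imProj (x : E) : D.lastProj (D.imProj x) = 0 := by
  rw [imProj_apply, map_sub, lastProj_lastProj, sub_self]

/-- Multiplication by `ε^{w i}` on `N_{i+1}^c`. -/
noncomputable def scale (w : ℕ → ℕ) (ε : 𝕜) : E →L[𝕜] E :=
  ∑ i ∈ Finset.range (k + 1), ε ^ w i • D.compProj i

theorem continuous_scale (w : ℕ → ℕ) : Continuous (D.scale w) := by
  unfold scale
  fun_prop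

theorem scale_apply (w : ℕ → ℕ) (ε : 𝕜) (x : E) :
    D.scale w ε x = ∑ i ∈ Finset.range (k + 1), ε ^ w i • D.compProj i x := by
  rw [scale, sum_apply]
  rfl

theorem lastProj_scale (w : ℕ → ℕ) (ε : 𝕜) (x : E) : D.lastProj (D.scale w ε x) = 0 := by
  rw [scale_apply, map_sum]
  refine Finset.sum_eq_zero fun i hi => ?_
  rw [map_smul, D.lastProj_compProj (by have := Finset.mem_range.1 hi; omega), smul_zero]

theorem scale_lastProj (w : ℕ → ℕ) (ε : 𝕜) (x : E) : D.scale w ε (D.lastProj x) = 0 := by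
  rw [scale_apply]
  refine Finset.sum_eq_zero fun i hi => ?_
  rw [D.compProj_lastProj (by have := Finset.mem_range.1 hi; omega), smul_zero]

theorem scale_imProj (w : ℕ → ℕ) (ε : 𝕜) (x : E) : D.scale w ε (D.imProj x) = D.scale w ε x := by
  rw [imProj_apply, map_sub, scale_lastProj, sub_zero]

theorem imProj_scale (w : ℕ → ℕ) (ε : 𝕜) (x : E) : D.imProj (D.scale w ε x) = D.scale w ε x := by
  rw [imProj_apply, lastProj_scale, sub_zero]

theorem compProj_scale (w : ℕ → ℕ) (ε : 𝕜) {j : ℕ} (hj : j ≤ k) (x : E) :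
    D.compProj j (D.scale w ε x) = ε ^ w j • D.compProj j x := by
  rw [scale_apply, map_sum, Finset.sum_eq_single_of_mem j (Finset.mem_range.2 (by omega))]
  · rw [map_smul, D.compProj_compProj hj, if_pos rfl]
  · intro i hi hij
    rw [map_smul, D.compProj_compProj (by have := Finset.mem_range.1 hi; omega), if_neg hij.symm,
      smul_zero]

/-- Used with the weights `i` and `k - i`: a scaling and its complement multiply to `ε^k` on `N^c`,
which is the source of the order `k` of the inverse. -/
theorem scale_scale {w w' : ℕ → ℕ} {n : ℕ} (h : ∀ i ≤ k, w i + w' i = n) (ε : 𝕜) (x : E) :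
    D.scale w ε (D.scale w' ε x) = ε ^ n • D.imProj x := by
  rw [scale_apply, imProj_eq_sum, Finset.smul_sum]
  refine Finset.sum_congr rfl fun i hi => ?_
  have hi' : i ≤ k := by have := Finset.mem_range.1 hi; omega
  rw [D.compProj_scale _ _ hi', smul_smul, ← pow_add, h i hi']

/-- The chain polynomials assembled along `E = N_1^c ⊕ ⋯ ⊕ N_{k+1}^c ⊕ N_{k+1}`. -/
noncomputable def blowUp (ε : 𝕜) : E →L[𝕜] E :=
  ∑ i ∈ Finset.range (k + 1), (D.chain (i + 1) ε) ∘L D.compProj i +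
    (D.chain (k + 1) ε) ∘L D.lastProj

theorem continuousNear_chain (j : ℕ) : ContinuousNear (D.chain j) :=
  .of_continuous (continuous_chainPoly _ _ _)

theorem continuousNear_blowUp : ContinuousNear D.blowUp :=
  (ContinuousNear.sum fun i _ => (D.continuousNear_chain (i + 1)).clm_comp_const _).add
    ((D.continuousNear_chain (k + 1)).clm_comp_const _)

theorem chain_zero (j : ℕ) : D.chain j 0 = ContinuousLinearMap.id 𝕜 E := by
  obtain ⟨Q, -, hQ⟩ := exists_chainPoly_eq D.sb D.SinvP j
  rw [chain, hQ, zero_smul, add_zero]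

theorem blowUp_zero : D.blowUp 0 = ContinuousLinearMap.id 𝕜 E := by
  simp only [blowUp, chain_zero, ContinuousLinearMap.id_comp]
  exact D.sum_compProj (k + 1)

theorem blowUp_lastProj (ε : 𝕜) (x : E) :
    D.blowUp ε (D.lastProj x) = D.chain (k + 1) ε (D.lastProj x) := by
  rw [blowUp, add_apply, sum_apply, Finset.sum_eq_zero, zero_add, ContinuousLinearMap.comp_apply,
    lastProj_lastProj]
  intro i hi
  rw [ContinuousLinearMap.comp_apply, D.compProj_lastProj (by have := Finset.mem_range.1 hi; omega),
    map_zero]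

theorem leadOp_imProj (x : E) : D.leadOp (D.imProj x) = D.leadOp x := by
  have h1 : D.leadOp ∘L D.leadInv ∘L D.leadOp = D.leadOp := by
    rw [← ContinuousLinearMap.comp_assoc, D.leadOp_comp_leadInv, ContinuousLinearMap.sub_comp,
      D.PRc_comp_leadOp, sub_zero, ContinuousLinearMap.id_comp]
  rw [D.leadInv_comp_leadOp] at h1
  exact congrArg (fun A : E →L[𝕜] F => A x) h1

variable {D} {L : 𝕜 → E →L[𝕜] F} {c : ℕ → E →L[𝕜] F}

/-- The blown-up family: on `N^c` it is a perturbation of `leadOp`, on `N_{k+1}` it is of order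
`k + 1`. -/
theorem IsAdapted.exists_blowUp (h : D.IsAdapted L c) :
    ∃ A H : 𝕜 → E →L[𝕜] F, ContinuousNear A ∧ ContinuousNear H ∧
      (∀ ε x, A ε (D.imProj x) = A ε x) ∧
      ∀ ε x, L ε (D.blowUp ε x) = D.leadOp (D.scale id ε x) + ε • A ε (D.scale id ε x) +
        ε ^ (k + 1) • H ε (D.lastProj x) := by
  have hchain : ∀ j ≤ k, _ := fun j hj => h.exists_chain_succ (j := j) hj
  choose! H hH hHx using hchain
  set A : 𝕜 → E →L[𝕜] F := fun ε => ∑ i ∈ Finset.range (k + 1), (H i ε) ∘L D.compProj i with hA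
  have hAc : ∀ ε, ∀ j ≤ k, ∀ x, A ε (D.compProj j x) = H j ε (D.compProj j x) := by
    intro ε j hj x
    simp only [hA]
    rw [sum_apply, Finset.sum_eq_single_of_mem j (Finset.mem_range.2 (by omega))]
    · rw [ContinuousLinearMap.comp_apply, D.compProj_compProj hj, if_pos rfl]
    · intro i _ hij
      rw [ContinuousLinearMap.comp_apply, D.compProj_compProj hj, if_neg hij, map_zero]
  refine ⟨A, H k, ?_, hH k le_rfl, fun ε x => ?_, fun ε x => ?_⟩
  · refine ContinuousNear.sum fun i hi => ?_
    exact (hH i (by have := Finset.mem_range.1 hi; omega)).clm_comp_const _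
  · rw [imProj_apply, map_sub, sub_eq_self]
    simp only [hA]
    rw [sum_apply]
    refine Finset.sum_eq_zero fun i hi => ?_
    rw [ContinuousLinearMap.comp_apply,
      D.compProj_lastProj (by have := Finset.mem_range.1 hi; omega), map_zero]
  · have hlast : L ε (D.chain (k + 1) ε (D.lastProj x)) = ε ^ (k + 1) • H k ε (D.lastProj x) := by
      obtain ⟨h1, h2⟩ := D.mem_Nk_succ.1 (D.kerProj_mem le_rfl x)
      rw [hHx k le_rfl ε _ h1, h2, smul_zero, zero_add, smul_smul, ← pow_succ]
    rw [blowUp, add_apply, map_add, ContinuousLinearMap.comp_apply, hlast]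
    congr 1
    rw [sum_apply, map_sum, scale_apply, map_sum, map_sum, Finset.smul_sum,
      ← Finset.sum_add_distrib]
    refine Finset.sum_congr rfl fun i hi => ?_
    have hi' : i ≤ k := by have := Finset.mem_range.1 hi; omega
    rw [ContinuousLinearMap.comp_apply, hHx i hi' ε _ (D.Nc_le hi' (D.compProj_mem hi' x)),
      map_smul, map_smul, D.leadOp_of_mem_Nc hi' (D.compProj_mem hi' x), hAc ε i hi', smul_add,
      smul_comm ε]
    rfl

variable [CompleteSpace E]

/-- A right inverse of order `k` forces `R_{k+1}^c = 0`. -/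
theorem IsAdapted.Rc_eq_bot (h : D.IsAdapted L c) {U : Submodule 𝕜 E}
    (hU : InvertibleOfOrder L U k) : D.Rc (k + 1) = ⊥ := by
  rw [← D.PRc_eq_zero_iff]
  obtain ⟨A, H, hA, hH, -, hL⟩ := h.exists_blowUp
  obtain ⟨Y, hY, -, hYinv⟩ := D.continuousNear_blowUp.exists_inverse D.blowUp_zero
  obtain ⟨hinv, hO⟩ := hU
  obtain ⟨bJ, hbJ⟩ := hO.bound
  obtain ⟨bA, hbA⟩ := hA.isBigO_one.bound
  obtain ⟨bH, hbH⟩ := hH.isBigO_one.bound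
  obtain ⟨bY, hbY⟩ := hY.isBigO_one.bound
  ext y
  rw [zero_apply]
  set P := D.PRc (k + 1) with hP
  set Γ := D.leadInv with hΓ
  -- a bound for the error term and for the main term
  set Ce : ℝ := bH * (‖D.lastProj‖ * (bY * (bJ * ‖y‖))) with hCe
  set M : ℝ := 2 * (‖Γ‖ * ‖y‖ + ‖Γ‖ * Ce) with hM
  have hsmall : ∀ᶠ ε in 𝓝 (0 : 𝕜), ‖ε‖ * (‖Γ‖ * bA) < 1 / 2 := by
    have hc : Continuous fun ε : 𝕜 => ‖ε‖ * (‖Γ‖ * bA) := by fun_prop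
    refine hc.continuousAt.eventually (gt_mem_nhds ?_)
    simp
  have key : ∀ᶠ ε in 𝓝[≠] (0 : 𝕜), ‖P y‖ ≤ ‖ε‖ * (‖P‖ * (bA * M) + ‖P‖ * Ce) := by
    filter_upwards [hinv, hbJ, hbA.filter_mono nhdsWithin_le_nhds,
      hbH.filter_mono nhdsWithin_le_nhds, hbY.filter_mono nhdsWithin_le_nhds,
      hYinv.filter_mono nhdsWithin_le_nhds, hsmall.filter_mono nhdsWithin_le_nhds,
      self_mem_nhdsWithin,
      mem_nhdsWithin_of_mem_nhds (Metric.ball_mem_nhds (0 : 𝕜) one_pos)]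
      with ε hinv hbJ hbA hbH hbY hYinv hsmall hε0 hε1
    have hε : 0 < ‖ε‖ := norm_pos_iff.2 hε0
    rw [mem_ball_zero_iff] at hε1
    rw [norm_one, mul_one] at hbA hbH hbY
    rw [norm_inv, norm_pow, norm_norm] at hbJ
    have hbA0 : 0 ≤ bA := (norm_nonneg _).trans hbA
    have hbH0 : 0 ≤ bH := (norm_nonneg _).trans hbH
    have hbY0 : 0 ≤ bY := (norm_nonneg _).trans hbY
    set J := (L ε ∘L U.subtypeL).inverse with hJ
    have hLJ : L ε (J y) = y := by
      have := hinv.self_apply_inverse y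
      exact this
    set x : E := Y ε (J y) with hx
    set m : E := D.scale id ε x with hm
    set e : F := ε ^ (k + 1) • H ε (D.lastProj x) with he
    -- Here `J y` solves `L(ε) u = y`, and `x` is its preimage under `blowUp`.
    have hy : y = D.leadOp m + ε • A ε m + e := by
      rw [← hL, hx, hYinv.1, hLJ]
    have hxn : ‖x‖ ≤ bY * (bJ * (‖ε‖ ^ k)⁻¹ * ‖y‖) := by
      refine (ContinuousLinearMap.le_opNorm _ _).trans ?_
      gcongr
      refine (ContinuousLinearMap.le_opNorm J y).trans ?_
      gcongr
    -- The factor `ε^{k+1}` outweighs the growth `‖ε‖^{-k}` of the inverse by one power.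
    have hen : ‖e‖ ≤ ‖ε‖ * Ce := by
      rw [he, norm_smul, norm_pow]
      calc ‖ε‖ ^ (k + 1) * ‖H ε (D.lastProj x)‖
          ≤ ‖ε‖ ^ (k + 1) * (bH * (‖D.lastProj‖ * (bY * (bJ * (‖ε‖ ^ k)⁻¹ * ‖y‖)))) := by
            gcongr
            refine (ContinuousLinearMap.le_opNorm _ _).trans ?_
            gcongr
            refine (ContinuousLinearMap.le_opNorm _ _).trans ?_
            gcongr
        _ = ‖ε‖ * Ce := by
            rw [hCe]
            field_simp
            ring
    -- Read off from the estimate for `e`, as the sign of the constant `bJ` is not known.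
    have hCe0 : 0 ≤ Ce := by
      by_contra hneg
      have : ‖ε‖ * Ce < 0 := mul_neg_of_pos_of_neg hε (not_le.1 hneg)
      linarith [norm_nonneg e]
    have hAm : ‖A ε m‖ ≤ bA * ‖m‖ :=
      (ContinuousLinearMap.le_opNorm _ _).trans (by gcongr)
    have hmeq : m = Γ y - ε • Γ (A ε m) - Γ e := by
      have h1 : Γ (D.leadOp m) = m := by
        have := congrArg (fun B : E →L[𝕜] E => B m) D.leadInv_comp_leadOp
        refine this.trans ?_
        rw [hm]
        exact D.imProj_scale id ε x
      conv_rhs => rw [hy]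
      rw [map_add, map_add, map_smul, h1]
      abel
    -- The inverse bound alone would let `x` blow up; the scaled vector `m` stays bounded because
    -- `leadInv` recovers it from `y`. The term with `A` is at most `‖m‖ / 2` and is absorbed,
    -- whence the factor `2` in `M`.
    have hmn : ‖m‖ ≤ M := by
      have h1 : ‖m‖ ≤ ‖Γ‖ * ‖y‖ + ‖ε‖ * (‖Γ‖ * (bA * ‖m‖)) + ‖Γ‖ * (‖ε‖ * Ce) := by
        conv_lhs => rw [hmeq]
        refine (norm_sub_le _ _).trans (add_le_add ((norm_sub_le _ _).trans (add_le_add ?_ ?_)) ?_)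
        · exact ContinuousLinearMap.le_opNorm _ _
        · rw [norm_smul]
          gcongr
          exact (ContinuousLinearMap.le_opNorm _ _).trans (by gcongr)
        · exact (ContinuousLinearMap.le_opNorm _ _).trans (by gcongr)
      have h2 : ‖ε‖ * (‖Γ‖ * (bA * ‖m‖)) ≤ 1 / 2 * ‖m‖ := by
        calc _ = ‖ε‖ * (‖Γ‖ * bA) * ‖m‖ := by ring
          _ ≤ _ := by gcongr
      have h3 : ‖Γ‖ * (‖ε‖ * Ce) ≤ ‖Γ‖ * Ce := by
        gcongr
        exact mul_le_of_le_one_left hCe0 hε1.le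
      rw [hM]
      linarith
    have hPy : P y = ε • P (A ε m) + P e := by
      have h1 : P (D.leadOp m) = 0 :=
        congrArg (fun B : E →L[𝕜] F => B m) D.PRc_comp_leadOp
      conv_lhs => rw [hy]
      rw [map_add, map_add, map_smul, h1, zero_add]
    rw [hPy]
    calc ‖ε • P (A ε m) + P e‖ ≤ ‖ε‖ * (‖P‖ * (bA * M)) + ‖P‖ * (‖ε‖ * Ce) := by
          refine (norm_add_le _ _).trans (add_le_add ?_ ?_)
          · rw [norm_smul]
            gcongr
            refine (ContinuousLinearMap.le_opNorm _ _).trans ?_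
            gcongr
            exact hAm.trans (by gcongr)
          · exact (ContinuousLinearMap.le_opNorm _ _).trans (by gcongr)
      _ = _ := by ring
  have hlim : Tendsto (fun ε : 𝕜 => ‖ε‖ * (‖P‖ * (bA * M) + ‖P‖ * Ce)) (𝓝[≠] 0) (𝓝 0) := by
    have hc : Continuous fun ε : 𝕜 => ‖ε‖ * (‖P‖ * (bA * M) + ‖P‖ * Ce) := by fun_prop
    simpa using (hc.tendsto 0).mono_left nhdsWithin_le_nhds
  exact norm_le_zero_iff.1 (ge_of_tendsto hlim key)

end FineResolution

/-! ### Splitting of the family when `R_{k+1}^c = 0`. -/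

namespace FineResolution

variable {𝕜 E F : Type*} [RCLike 𝕜] [NormedAddCommGroup E] [NormedSpace 𝕜 E]
  [NormedAddCommGroup F] [NormedSpace 𝕜 F] {G : E → F} {z₀ : 𝕜 → E} {k l : ℕ}
  {D : FineResolution G z₀ k l} {L : 𝕜 → E →L[𝕜] F} {c : ℕ → E →L[𝕜] F}

/-- Otherwise `N^c` would be all of `E` and contain `z̄_l`. -/
theorem lastProj_ne_zero (D : FineResolution G z₀ k l) : D.lastProj ≠ 0 := by
  intro h0
  refine D.leading_notMem ?_
  have h1 : D.imProj (curveCoeff z₀ l) = curveCoeff z₀ l := by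
    rw [imProj_apply, h0]
    exact sub_zero _
  rw [← h1, imProj_eq_sum]
  refine Submodule.sum_mem _ fun i hi => ?_
  have hi' : i ≤ k := by have := Finset.mem_range.1 hi; omega
  exact Submodule.mem_iSup_of_mem (i + 1) (Submodule.mem_iSup_of_mem
    (Finset.mem_Icc.2 ⟨by omega, by omega⟩) (D.compProj_mem hi' _))

/-- `leadOp` is onto the nonzero space `F` and factors through `imProj`. -/
theorem imProj_ne_zero [Nontrivial F] (hD : D.Rc (k + 1) = ⊥) : D.imProj ≠ 0 := by
  intro h0
  obtain ⟨y, hy⟩ := exists_ne (0 : F)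
  have h1 := congrArg (fun B : F →L[𝕜] F => B y) D.leadOp_comp_leadInv
  rw [D.PRc_eq_zero_iff.2 hD, sub_zero] at h1
  have h2 : D.leadOp (D.leadInv y) = y := h1
  rw [← D.leadOp_imProj, h0] at h2
  exact hy (by rw [← h2]; simp)

variable [CompleteSpace F]

/-- If `R_{k+1}^c = 0`, the blown-up family has a continuous right inverse near the origin. -/
theorem exists_blowUp_inverse {A : 𝕜 → E →L[𝕜] F} (hA : ContinuousNear A)
    (hAp : ∀ ε x, A ε (D.imProj x) = A ε x) (hD : D.Rc (k + 1) = ⊥) :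
    ∃ B : 𝕜 → F →L[𝕜] E, ContinuousNear B ∧ ∀ᶠ ε in 𝓝 (0 : 𝕜),
      (∀ y, D.leadOp (B ε y) + ε • A ε (B ε y) = y) ∧
      ∀ x, B ε (D.leadOp x + ε • A ε x) = D.imProj x := by
  have hP : D.PRc (k + 1) = 0 := D.PRc_eq_zero_iff.2 hD
  have h1 : D.leadOp ∘L D.leadInv = ContinuousLinearMap.id 𝕜 F := by
    rw [D.leadOp_comp_leadInv, hP, sub_zero]
  -- This is `(leadOp + ε A) ∘ leadInv`, the identity at `ε = 0`; the right inverse is `leadInv`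
  -- followed backwards through `f⁻¹`, that is `leadInv ∘ f⁻¹`.
  set f : 𝕜 → F →L[𝕜] F := fun ε => D.leadOp ∘L D.leadInv + ε • (A ε ∘L D.leadInv) with hf
  have hfc : ContinuousNear f :=
    (ContinuousNear.const _).add (hA.clm_comp_const _).self_smul
  obtain ⟨g, hg, -, hgf⟩ := hfc.exists_inverse (by simp [hf, h1])
  refine ⟨fun ε => D.leadInv ∘L g ε, ContinuousNear.const_clm_comp _ hg, ?_⟩
  filter_upwards [hgf] with ε hε
  refine ⟨fun y => hε.1 y, fun x => ?_⟩
  have h2 : D.imProj x = D.leadInv (D.leadOp x) :=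
    (congrArg (fun B : E →L[𝕜] E => B x) D.leadInv_comp_leadOp).symm
  have h3 : D.leadOp x + ε • A ε x = f ε (D.leadOp x) := by
    rw [← D.leadOp_imProj x, ← hAp ε x, h2]
    have h4 : D.leadOp (D.leadInv (D.leadOp x)) = D.leadOp x :=
      congrArg (fun B : F →L[𝕜] F => B (D.leadOp x)) h1
    rw [h4]
    simp only [hf]
    rw [h1]
    rfl
  rw [h3, ContinuousLinearMap.comp_apply, hε.2, h2]

/-- If `R_{k+1}^c = 0`, the blow-up can be corrected so that the family is diagonalized. -/
theorem IsAdapted.exists_diagonalization (h : D.IsAdapted L c) (hD : D.Rc (k + 1) = ⊥) :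
    ∃ (B : 𝕜 → F →L[𝕜] E) (Q Z : 𝕜 → E →L[𝕜] E), ContinuousNear B ∧ ContinuousNear Q ∧
      ContinuousNear Z ∧ Z 0 = ContinuousLinearMap.id 𝕜 E ∧ ∃ A : 𝕜 → E →L[𝕜] F,
      ∀ᶠ ε in 𝓝 (0 : 𝕜), (∀ y, A ε (B ε y) = y) ∧ (∀ x, B ε (A ε x) = D.imProj x) ∧
        (∀ x, A ε (D.imProj x) = A ε x) ∧
        (∀ x, L ε (D.lastProj x + ε • Q ε (D.lastProj x)) = 0) ∧
        ∀ x, L ε (Z ε x) = A ε (D.scale id ε x) := by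
  obtain ⟨A, H, hA, hH, hAp, hL⟩ := h.exists_blowUp
  obtain ⟨B, hB, hBA⟩ := exists_blowUp_inverse hA hAp hD
  obtain ⟨Q, hQ, hQe⟩ := exists_chainPoly_eq D.sb D.SinvP (k + 1)
  -- Chosen so that `L X = ε^k H`: the complementary scaling turns `scale id` into `ε^k`, and `B`
  -- inverts `leadOp + ε A`. Subtracting `ε X` on `N_{k+1}` then cancels the term `ε^{k+1} H`
  -- exactly.
  set X : 𝕜 → E →L[𝕜] E := fun ε =>
    D.blowUp ε ∘L D.scale (fun i => k - i) ε ∘L B ε ∘L H ε with hX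
  have hXc : ContinuousNear X := D.continuousNear_blowUp.clm_comp
    ((ContinuousNear.of_continuous (D.continuous_scale _)).clm_comp (hB.clm_comp hH))
  refine ⟨B, fun ε => Q ε - X ε, fun ε => D.blowUp ε - ε • (X ε ∘L D.lastProj), hB,
    (ContinuousNear.of_continuous hQ).sub hXc,
    D.continuousNear_blowUp.sub (hXc.clm_comp_const _).self_smul,
    by beta_reduce; rw [zero_smul, sub_zero, D.blowUp_zero], fun ε => D.leadOp + ε • A ε, ?_⟩
  filter_upwards [hBA] with ε hε
  have hAim : ∀ x, (D.leadOp + ε • A ε) (D.imProj x) = (D.leadOp + ε • A ε) x := by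
    intro x
    rw [add_apply, smul_apply, hAp, D.leadOp_imProj]
    rfl
  have hLX : ∀ x, L ε (X ε x) = ε ^ k • H ε x := by
    intro x
    have h1 : D.scale id ε (D.scale (fun i => k - i) ε (B ε (H ε x))) =
        ε ^ k • D.imProj (B ε (H ε x)) :=
      D.scale_scale (n := k) (fun i hi => Nat.add_sub_cancel' hi) ε _
    have h2 := hAim (B ε (H ε x))
    simp only [hX, ContinuousLinearMap.comp_apply]
    rw [hL, D.lastProj_scale, map_zero, smul_zero, add_zero, h1, map_smul, map_smul, smul_comm ε,
      ← smul_add]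
    congr 1
    refine h2.trans (hε.1 _)
  have hLlast : ∀ x, L ε (D.blowUp ε (D.lastProj x)) = ε ^ (k + 1) • H ε (D.lastProj x) := by
    intro x
    rw [hL, D.scale_lastProj, map_zero, map_zero, smul_zero, add_zero, zero_add,
      D.lastProj_lastProj]
  refine ⟨hε.1, hε.2, hAim, fun x => ?_, fun x => ?_⟩
  · have h1 : D.lastProj x + ε • (Q ε - X ε) (D.lastProj x) =
        D.blowUp ε (D.lastProj x) - ε • X ε (D.lastProj x) := by
      rw [D.blowUp_lastProj, chain, hQe, add_apply, smul_apply, sub_apply, smul_sub,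
        ContinuousLinearMap.id_apply]
      abel
    rw [h1, map_sub, hLlast, map_smul, hLX, smul_smul, ← pow_succ', sub_self]
  · rw [sub_apply, smul_apply, map_sub, map_smul, ContinuousLinearMap.comp_apply, hLX, hL,
      smul_smul, ← pow_succ', add_sub_cancel_right]
    rfl

variable [CompleteSpace E]

/-- If `R_{k+1}^c = 0`, the family splits along `E = N^c ⊕ N_{k+1}`. -/
theorem IsAdapted.exists_splitting [Nontrivial F] (h : D.IsAdapted L c) (hD : D.Rc (k + 1) = ⊥) :
    ∃ U V : Submodule 𝕜 E, IsClosed (U : Set E) ∧ IsClosed (V : Set E) ∧ U ≠ ⊥ ∧ V ≠ ⊥ ∧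
      IsCompl U V ∧ InvertibleOfOrder L U k ∧
      ∃ δ > (0 : ℝ), ∃ Q : 𝕜 → V →L[𝕜] E, ContinuousOn Q (Metric.ball 0 δ) ∧
        ∀ ε ∈ Metric.ball (0 : 𝕜) δ, ∀ v : V, L ε (perturbedInclusion Q ε v) = 0 := by
  obtain ⟨B, Q, Z, hB, hQ, hZ, hZ0, A, hA⟩ := h.exists_diagonalization hD
  set U : Submodule 𝕜 E := LinearMap.ker (D.lastProj : E →ₗ[𝕜] E) with hUdef
  set V : Submodule 𝕜 E := LinearMap.ker (D.imProj : E →ₗ[𝕜] E) with hVdef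
  have memU : ∀ {x}, x ∈ U ↔ D.lastProj x = 0 := Iff.rfl
  have memV : ∀ {x}, x ∈ V ↔ D.imProj x = 0 := Iff.rfl
  have imU : ∀ {x}, x ∈ U → D.imProj x = x := fun hx => by
    rw [imProj_apply, memU.1 hx, sub_zero]
  refine ⟨U, V, D.lastProj.isClosed_ker, D.imProj.isClosed_ker, ?_, ?_, ?_, ?_, ?_⟩
  · intro hU
    refine imProj_ne_zero hD (ContinuousLinearMap.ext fun x => ?_)
    have : D.imProj x ∈ U := D.lastProj_imProj x
    rw [hU] at this
    exact (Submodule.mem_bot 𝕜).1 this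
  · intro hV
    refine D.lastProj_ne_zero (ContinuousLinearMap.ext fun x => ?_)
    have : D.lastProj x ∈ V := D.imProj_lastProj x
    rw [hV] at this
    exact (Submodule.mem_bot 𝕜).1 this
  · rw [isCompl_iff, disjoint_iff, codisjoint_iff, eq_bot_iff, eq_top_iff]
    refine ⟨fun x hx => ?_, fun x _ => ?_⟩
    · rw [Submodule.mem_bot, ← imU hx.1]
      exact hx.2
    · refine Submodule.mem_sup.2 ⟨D.imProj x, D.lastProj_imProj x, D.lastProj x,
        D.imProj_lastProj x, ?_⟩
      rw [imProj_apply, sub_add_cancel]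
  · obtain ⟨Zi, hZi, hZi0, hZZ⟩ := hZ.exists_inverse hZ0
    -- `L = A ∘ scale ∘ Z⁻¹`, and `scale` sees only the `N^c`-component of `Z⁻¹`. So the block
    -- `imProj ∘ Z⁻¹` on `U` has to be inverted; completing it by the identity on `N_{k+1}` gives a
    -- near-identity operator on all of `E`.
    set K : 𝕜 → E →L[𝕜] E := fun ε => D.imProj ∘L Zi ε ∘L D.imProj + D.lastProj with hK
    have hKc : ContinuousNear K :=
      (ContinuousNear.const_clm_comp _ (hZi.clm_comp_const _)).add (.const _)
    have hK0 : K 0 = ContinuousLinearMap.id 𝕜 E := by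
      ext x
      simp only [hK, hZi0, add_apply, ContinuousLinearMap.comp_apply, ContinuousLinearMap.id_apply]
      rw [imU (D.lastProj_imProj x), imProj_apply, sub_add_cancel]
    obtain ⟨Ki, hKi, -, hKK⟩ := hKc.exists_inverse hK0
    set J : 𝕜 → F →L[𝕜] E := fun ε => Ki ε ∘L D.scale (fun i => k - i) ε ∘L B ε with hJ
    have hJc : ContinuousNear J :=
      hKi.clm_comp ((ContinuousNear.of_continuous (D.continuous_scale _)).clm_comp hB)
    have hlastK : ∀ ε x, D.lastProj (K ε x) = D.lastProj x := by
      intro ε x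
      simp only [hK, add_apply, ContinuousLinearMap.comp_apply]
      rw [map_add, D.lastProj_imProj, D.lastProj_lastProj, zero_add]
    have hKU : ∀ ε x, x ∈ U → K ε x = D.imProj (Zi ε x) := by
      intro ε x hx
      simp only [hK, add_apply, ContinuousLinearMap.comp_apply]
      rw [imU hx, memU.1 hx, add_zero]
    have hinv : ∀ᶠ ε in 𝓝[≠] (0 : 𝕜), ∃ J' : F →L[𝕜] U, ‖J'‖ ≤ (‖ε‖ ^ k)⁻¹ * ‖J ε‖ ∧
        (L ε ∘L U.subtypeL) ∘L J' = ContinuousLinearMap.id 𝕜 F ∧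
        J' ∘L (L ε ∘L U.subtypeL) = ContinuousLinearMap.id 𝕜 U := by
      filter_upwards [hA.filter_mono nhdsWithin_le_nhds, hZZ.filter_mono nhdsWithin_le_nhds,
        hKK.filter_mono nhdsWithin_le_nhds, self_mem_nhdsWithin] with ε hA hZZ hKK hε0
      obtain ⟨hAB, hBA, hAim, -, hLZ⟩ := hA
      have hεk : ε ^ k ≠ 0 := pow_ne_zero k hε0
      have hL : ∀ x, L ε x = A ε (D.scale id ε (Zi ε x)) := fun x => by rw [← hLZ, hZZ.1]
      have hJU : ∀ y, J ε y ∈ U := by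
        intro y
        rw [memU, ← hlastK ε]
        simp only [hJ, ContinuousLinearMap.comp_apply]
        rw [hKK.1, D.lastProj_scale]
      have hLJ : ∀ y, L ε (J ε y) = ε ^ k • y := by
        intro y
        have h1 : D.imProj (Zi ε (J ε y)) = D.scale (fun i => k - i) ε (B ε y) := by
          rw [← hKU ε _ (hJU y)]
          simp only [hJ, ContinuousLinearMap.comp_apply]
          rw [hKK.1]
        rw [hL, ← D.scale_imProj, h1,
          D.scale_scale (w := id) (w' := fun i => k - i) (n := k)
            (fun i hi => Nat.add_sub_cancel' hi) ε, map_smul, hAim, hAB]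
      have hJL : ∀ x ∈ U, J ε (L ε x) = ε ^ k • x := by
        intro x hx
        rw [hL]
        simp only [hJ, ContinuousLinearMap.comp_apply]
        rw [hBA, D.scale_imProj, D.scale_scale (w := fun i => k - i) (w' := id) (n := k)
            (fun i hi => Nat.sub_add_cancel hi) ε,
          map_smul, ← hKU ε x hx, hKK.2]
      -- `J` inverts `L` on `U` up to the factor `ε^k` and is bounded near the origin, whence the
      -- order `k`.
      refine ⟨(ε ^ k)⁻¹ • (J ε).codRestrict U hJU, ?_, ?_, ?_⟩
      · rw [norm_smul, norm_inv, norm_pow]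
        gcongr
        refine ContinuousLinearMap.opNorm_le_bound _ (norm_nonneg _) fun y => ?_
        exact (J ε).le_opNorm y
      · ext y
        have h1 := hLJ y
        simp only [ContinuousLinearMap.comp_apply, smul_apply, map_smul,
          ContinuousLinearMap.id_apply]
        exact (congrArg ((ε ^ k)⁻¹ • ·) h1).trans (inv_smul_smul₀ hεk y)
      · ext x
        have h1 := hJL x x.2
        simp only [ContinuousLinearMap.comp_apply, smul_apply, ContinuousLinearMap.id_apply]
        exact (congrArg ((ε ^ k)⁻¹ • ·) h1).trans (inv_smul_smul₀ hεk (x : E))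
    refine ⟨?_, ?_⟩
    · filter_upwards [hinv] with ε hε
      obtain ⟨J', -, h1, h2⟩ := hε
      exact ContinuousLinearMap.IsInvertible.of_inverse h1 h2
    · obtain ⟨b, hb⟩ := hJc.isBigO_one.bound
      refine IsBigO.of_bound b ?_
      filter_upwards [hinv, hb.filter_mono nhdsWithin_le_nhds] with ε hε hbε
      obtain ⟨J', h0, h1, h2⟩ := hε
      rw [norm_one, mul_one] at hbε
      rw [ContinuousLinearMap.inverse_eq h1 h2, norm_inv, norm_pow, norm_norm, mul_comm]
      exact h0.trans (by gcongr)
  · have hev : ∀ᶠ ε in 𝓝 (0 : 𝕜), ContinuousAt Q ε ∧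
        ∀ x, L ε (D.lastProj x + ε • Q ε (D.lastProj x)) = 0 :=
      hQ.and (hA.mono fun ε hε => hε.2.2.2.1)
    obtain ⟨δ, hδ, hball⟩ := Metric.eventually_nhds_iff_ball.1 hev
    refine ⟨δ, hδ, fun ε => Q ε ∘L V.subtypeL, fun ε hε => ?_, fun ε hε v => ?_⟩
    · exact ((hball ε hε).1.clm_comp continuousAt_const).continuousWithinAt
    · have hv : D.lastProj (v : E) = v := by
        have := memV.1 v.2
        rw [imProj_apply, sub_eq_zero] at this
        exact this.symm
      have h1 := (hball ε hε).2 v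
      rw [hv] at h1
      exact h1

end FineResolution

/-! ### Both families fit the resolution. -/

section Families

variable {𝕜 E F : Type*} [RCLike 𝕜] [NormedAddCommGroup E] [NormedSpace 𝕜 E]
  [NormedAddCommGroup F] [NormedSpace 𝕜 F] {G : E → F} {z₀ : 𝕜 → E} {k l q : ℕ}

theorem contDiffAt_linFamily (hq : 2 * k + 2 ≤ q) (hG : ContDiff 𝕜 q G)
    (hz₀ : ContDiffAt 𝕜 q z₀ 0) : ContDiffAt 𝕜 (2 * k + 1 : ℕ) (linFamily G z₀) 0 := by
  have h1 : ContDiff 𝕜 (2 * k + 1 : ℕ) (fderiv 𝕜 G) := hG.fderiv_right (by norm_cast)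
  exact h1.contDiffAt.comp (0 : 𝕜) (hz₀.of_le (by exact_mod_cast (by omega : 2 * k + 1 ≤ q)))

variable [CompleteSpace E] [CompleteSpace F]

theorem wt_smul_sb_eq (D : FineResolution G z₀ k l) (hq : 2 * k + 2 ≤ q)
    (hG : ContDiff 𝕜 q G) (hz₀ : ContDiffAt 𝕜 q z₀ 0) (hz₀0 : z₀ 0 = 0) {j : ℕ} (hj : j ≤ k) :
    wt 𝕜 j • D.sb (j + 1) = ∑ v ∈ Finset.range (j + 1),
      (taylorCoeff (linFamily G z₀) v) ∘L (chainCoeff D.sb D.SinvP v j) :=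
  wt_smul_Sbar (hG.contDiffAt.of_le (by exact_mod_cast (by omega : 2 * j + 2 ≤ q)))
    (hz₀.of_le (by exact_mod_cast (by omega : j + 2 ≤ q))) hz₀0

theorem isAdapted_linFamily (D : FineResolution G z₀ k l) (hk : 1 ≤ k) (hq : 2 * k + 2 ≤ q)
    (hG : ContDiff 𝕜 q G) (hz₀ : ContDiffAt 𝕜 q z₀ 0) (hz₀0 : z₀ 0 = 0) :
    D.IsAdapted (linFamily G z₀) (taylorCoeff (linFamily G z₀)) where
  expansion := exists_taylor_remainder ((contDiffAt_linFamily hq hG hz₀).of_le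
    (by exact_mod_cast (by omega : k + 1 + 1 ≤ 2 * k + 1)))
  wt_smul_sb _ hj := wt_smul_sb_eq D hq hG hz₀ hz₀0 hj

theorem isAdapted_taylorFamily (D : FineResolution G z₀ k l) (hq : 2 * k + 2 ≤ q)
    (hG : ContDiff 𝕜 q G) (hz₀ : ContDiffAt 𝕜 q z₀ 0) (hz₀0 : z₀ 0 = 0) :
    D.IsAdapted (taylorFamily G z₀ k) (taylorCoeff (linFamily G z₀)) where
  -- The polynomial is its own expansion, with the same coefficients up to order `k` and remainder
  -- zero.
  expansion := ⟨fun _ => 0, .const _, fun ε => by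
    rw [smul_zero, add_zero, taylorFamily]
    refine Finset.sum_congr rfl fun j _ => ?_
    rw [taylorCoeff, smul_smul, div_eq_mul_inv]⟩
  wt_smul_sb _ hj := wt_smul_sb_eq D hq hG hz₀ hz₀0 hj

end Families
end FineRes

theorem corollary1 {𝕜 E F : Type*} [RCLike 𝕜]
    [NormedAddCommGroup E] [NormedSpace 𝕜 E] [CompleteSpace E]
    [NormedAddCommGroup F] [NormedSpace 𝕜 F] [CompleteSpace F] [Nontrivial F]
    (k l q : ℕ) (hq : 2 * k + 2 ≤ q)
    (G : E → F) (hG : ContDiff 𝕜 q G) (hG0 : G 0 = 0)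
    (z₀ : 𝕜 → E) (hz₀ : ContDiffAt 𝕜 q z₀ 0) (hz₀0 : z₀ 0 = 0)
    (hl : 1 ≤ l) (hlk : l ≤ k) (hzl : FineRes.curveCoeff z₀ l ≠ 0)
    (hzlt : ∀ j, 1 ≤ j → j < l → FineRes.curveCoeff z₀ j = 0)
    (C : FineRes.Cone G z₀ k l) :
    List.TFAE [
      C.IsTransversal,
      ∃ U V : Submodule 𝕜 E, IsClosed (U : Set E) ∧ IsClosed (V : Set E) ∧ U ≠ ⊥ ∧ V ≠ ⊥ ∧
        IsCompl U V ∧ FineRes.InvertibleOfOrder (FineRes.linFamily G z₀) U k ∧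
        ∃ δ > (0 : ℝ), ∃ Q : 𝕜 → V →L[𝕜] E, ContinuousOn Q (Metric.ball 0 δ) ∧
          ∀ ε ∈ Metric.ball (0 : 𝕜) δ, ∀ v : V,
            FineRes.linFamily G z₀ ε (FineRes.perturbedInclusion Q ε v) = 0,
      ∃ U V : Submodule 𝕜 E, IsClosed (U : Set E) ∧ IsClosed (V : Set E) ∧ U ≠ ⊥ ∧ V ≠ ⊥ ∧
        IsCompl U V ∧ FineRes.InvertibleOfOrder (FineRes.taylorFamily G z₀ k) U k ∧
        ∃ δ > (0 : ℝ), ∃ Q : 𝕜 → V →L[𝕜] E, ContinuousOn Q (Metric.ball 0 δ) ∧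
          (fun ε : 𝕜 => FineRes.taylorFamily G z₀ k ε ∘L FineRes.perturbedInclusion Q ε)
            =O[𝓝 (0 : 𝕜)] fun ε : 𝕜 => ‖ε‖ ^ (k + 1)] := by
  have hk : 1 ≤ k := hl.trans hlk
  have hL := FineRes.isAdapted_linFamily C.toFineResolution hk hq hG hz₀ hz₀0
  have hP := FineRes.isAdapted_taylorFamily C.toFineResolution hq hG hz₀ hz₀0
  tfae_have 1 → 2 := fun h => hL.exists_splitting h
  tfae_have 2 → 1 := fun ⟨_, _, _, _, _, _, _, hU, _⟩ => hL.Rc_eq_bot hU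
  tfae_have 1 → 3 := by
    intro h
    obtain ⟨U, V, h1, h2, h3, h4, h5, h6, δ, hδ, Q, hQ, hzero⟩ := hP.exists_splitting h
    refine ⟨U, V, h1, h2, h3, h4, h5, h6, δ, hδ, Q, hQ, ?_⟩
    -- The splitting for the polynomial family annihilates `V` exactly near the origin, which is
    -- more than `O(|ε|^{k+1})`.
    refine IsBigO.of_bound 0 ?_
    filter_upwards [Metric.ball_mem_nhds (0 : 𝕜) hδ] with ε hε
    have : FineRes.taylorFamily G z₀ k ε ∘L FineRes.perturbedInclusion Q ε = 0 :=
      ContinuousLinearMap.ext (hzero ε hε)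
    rw [this, norm_zero, zero_mul]
  tfae_have 3 → 1 := fun ⟨_, _, _, _, _, _, _, hU, _⟩ => hP.Rc_eq_bot hU
  tfae_finish
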